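/- Let $h,\sigma:[0,1)\to\mathbb{R}$ be continuous with $\sigma>0$, let $B$ be a standard Brownian motion, put $\phi(t)=\exp\big(-\int_0^t h(r)\,dr\big)$, and for $x,y\in\mathbb{R}$ let $$X^{xy}_t=\phi(t)\,x+(1-\phi(t))\,y+\phi(t)\int_0^t\frac{\sigma(r)}{\phi(r)}\,dB_r,\qquad t\in[0,1),$$ be the (continuous) solution of $dX_t=h(t)(y-X_t)\,dt+\sigma(t)\,dB_t$, $X_0=x$. Assume that the family $\{X^{xy}\}$ is pinned, i.e. $\lim_{t\to1}X^{xy}_t=y$ almost surely for all $x,y\in\mathbb{R}$. A non-degenerate continuous Gaussian Markov process $Z$ is understood as a Markov process on $[0,1]$ with continuous paths such that, for every $x\in\mathbb{R}$, the process $Z^x$ (that is, $Z$ started in $x$) is Gaussian with $\operatorname{Var}(Z^x_t)>0$ for all $t\in(0,1]$; the transition kernels do not depend on $x$. Its bridge from $x$ to $y$ is the process on $[0,1)$ whose law is the conditional law of $(Z^x_t)_{t\in[0,1)}$ given $Z^x_1=y$, in the version whose finite-dimensional distributions depend weakly continuously on $y$. The family $\{X^{xy}\}$ is the family of bridges of $Z$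 if for all $x,y\in\mathbb{R}$ the process $X^{xy}$ has the same law as the bridge of $Z$ from $x$ to $y$. Then there is a non-degenerate continuous Gaussian Markov process $Z$ such that $\{X^{xy},\,x,y\in\mathbb{R}\}$ is the family of bridges of $Z$ if and only if $$\Sigma:=\lim_{t\to1}\int_0^t\sigma^2(r)\,dr<+\infty\qquad\text{and}\qquad h(t)=\frac{\sigma^2(t)}{\Sigma-\int_0^t\sigma^2(r)\,dr}\quad\text{for all }t\in[0,1).$$ In this case $Z$ can be taken with $dZ_t=\sigma(t)\,dB_t$: the process $\int_0^t\sigma(r)\,dB_r$, $t\in[0,1)$, extends continuously to $[0,1]$ almost surely, and $Z^x_t=x+\int_0^t\sigma(r)\,dB_r$, $t\in[0,1]$, is a non-degenerate continuous Gaussian Markov process whose family of bridges is $\{X^{xy}\}$. -/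

import Mathlib

open MeasureTheory ProbabilityTheory Filter Topology
open scoped NNReal ENNReal BoundedContinuousFunction

universe u

namespace PinnedBridges

noncomputable section

/-- The function `φ(t) = exp (-∫₀ᵗ h(r) dr)`. -/
def phi (h : ℝ → ℝ) (t : ℝ) : ℝ := Real.exp (-∫ r in (0 : ℝ)..t, h r)

/-- The left-endpoint sum `∑_{k < n} f(t k / n) (B_{t (k + 1) / n} - B_{t k / n})` along the
`n`-th equidistant partition of `[0, t]`. -/
def leftSum {Ω : Type*} (f : ℝ → ℝ) (B : ℝ≥0 → Ω → ℝ) (t : ℝ≥0) (n : ℕ) (ω : Ω) : ℝ :=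
  ∑ k ∈ Finset.range n,
    f ((t * (k : ℝ≥0) / (n : ℝ≥0) : ℝ≥0) : ℝ) *
      (B (t * ((k : ℝ≥0) + 1) / (n : ℝ≥0)) ω - B (t * (k : ℝ≥0) / (n : ℝ≥0)) ω)

/-- `M` is (a version with almost surely continuous paths of) the stochastic integral process
`M_t = ∫₀ᵗ f(r) dB_r`, `t ∈ [0, 1)`, of a deterministic function `f` which is continuous on `[0, 1)`
with respect to the Brownian motion `B`. For such an integrand, `∫₀ᵗ f dB` is the limit in `L²` of
the left-endpoint sums. Only the values of `M` at times `t < 1` matter. -/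
structure IsWienerIntegral {Ω : Type*} [MeasurableSpace Ω] (f : ℝ → ℝ) (B : ℝ≥0 → Ω → ℝ)
    (M : ℝ≥0 → Ω → ℝ) (P : Measure Ω) : Prop where
  memLp : ∀ t : ℝ≥0, t < 1 → MemLp (M t) 2 P
  tendsto : ∀ t : ℝ≥0, t < 1 →
    Tendsto (fun n : ℕ ↦ eLpNorm (fun ω ↦ leftSum f B t n ω - M t ω) 2 P) atTop (𝓝 0)
  continuous : ∀ᵐ ω ∂P, ContinuousOn (fun t ↦ M t ω) (Set.Iio 1)

/-- The process `X^{xy}_t = φ(t) x + (1 - φ(t)) y + φ(t) M_t`, `t ∈ [0, 1)`. With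
`M_t = ∫₀ᵗ σ(r) / φ(r) dB_r` it is the solution of `dX = h(t) (y - X) dt + σ(t) dB`, `X_0 = x`. -/
def diffusion {Ω : Type*} (h : ℝ → ℝ) (M : ℝ≥0 → Ω → ℝ) (x y : ℝ) (t : ℝ≥0) (ω : Ω) : ℝ :=
  phi h t * x + (1 - phi h t) * y + phi h t * M t ω

/-- The family `X x y` is pinned: almost surely `X^{xy}_t → y` as `t ↑ 1`, for all `x` and `y`. -/
def IsPinned {Ω : Type*} [MeasurableSpace Ω] (X : ℝ → ℝ → ℝ≥0 → Ω → ℝ) (P : Measure Ω) : Prop :=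
  ∀ x y : ℝ, ∀ᵐ ω ∂P, Tendsto (fun t : ℝ≥0 ↦ X x y t ω) (𝓝[<] 1) (𝓝 y)

/-- `Z x` is, for every real `x`, the process started in `x` of one non-degenerate continuous
Gaussian Markov process on `[0, 1]`. Only the values at times `t ≤ 1` matter. -/
structure IsGaussianMarkov {Ω : Type*} [MeasurableSpace Ω] (Z : ℝ → ℝ≥0 → Ω → ℝ)
    (P : Measure Ω) : Prop where
  gaussian : ∀ x : ℝ, IsGaussianProcess (fun t : Set.Iic (1 : ℝ≥0) ↦ Z x t) P
  continuous : ∀ x : ℝ, ∀ᵐ ω ∂P, ContinuousOn (fun t ↦ Z x t ω) (Set.Iic 1)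
  start : ∀ x : ℝ, ∀ᵐ ω ∂P, Z x 0 ω = x
  nondegenerate : ∀ (x : ℝ) (t : ℝ≥0), 0 < t → t ≤ 1 → 0 < variance (Z x t) P
  /-- The Markov property, with transition kernels `κ s t` that do not depend on the starting point:
  given `Z_s` and any finite number of values of the process before time `s`, the conditional law of
  `Z_t` is `κ s t (Z_s, ·)`. -/
  markov : ∃ κ : ℝ≥0 → ℝ≥0 → Kernel ℝ ℝ, ∀ s t : ℝ≥0, s ≤ t → t ≤ 1 →
    IsMarkovKernel (κ s t) ∧
    ∀ (x : ℝ) (J : Finset ℝ≥0), (∀ r ∈ J, r ≤ s) →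
      HasCondDistrib (Z x t) (fun ω ↦ (Z x s ω, J.restrict (fun r ↦ Z x r ω)))
        (Kernel.prodMkRight (J → ℝ) (κ s t)) P

/-- `κ y` is the joint law at the times in `J` of the process `W` conditioned on `W_1 = y`:
`κ` is a regular conditional distribution of `(W_t)_{t ∈ J}` given `W_1`, in the version that is
weakly continuous in `y`. If the law of `W_1` has full support (e.g. if it is Gaussian with positive
variance), there is at most one such `κ`, so that `κ y` is determined for every real `y`. -/
structure IsBridgeKernel {Ω : Type*} [MeasurableSpace Ω] (W : ℝ≥0 → Ω → ℝ) (P : Measure Ω)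
    (J : Finset ℝ≥0) (κ : Kernel ℝ (J → ℝ)) : Prop where
  isMarkovKernel : IsMarkovKernel κ
  hasCondDistrib : HasCondDistrib (fun ω ↦ J.restrict (fun t ↦ W t ω)) (W 1) κ P
  continuous : ∀ f : (J → ℝ) →ᵇ ℝ, Continuous (fun y : ℝ ↦ ∫ z, f z ∂(κ y))

/-- The family `X x y` is the family of bridges of `Z`: for all `x` and `y`, the process
`(X^{xy}_t)_{t ∈ [0, 1)}` has the law (i.e. the finite-dimensional distributions) of `Z` started in
`x` and conditioned to be in `y` at time `1`. -/
def AreBridges {Ω Ω' : Type*} [MeasurableSpace Ω] [MeasurableSpace Ω']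
    (X : ℝ → ℝ → ℝ≥0 → Ω → ℝ) (P : Measure Ω) (Z : ℝ → ℝ≥0 → Ω' → ℝ) (P' : Measure Ω') : Prop :=
  ∀ (x : ℝ) (J : Finset ℝ≥0), (∀ t ∈ J, t < 1) →
    ∃ κ : Kernel ℝ (J → ℝ), IsBridgeKernel (Z x) P' J κ ∧
      ∀ y : ℝ, HasLaw (fun ω ↦ J.restrict (fun t ↦ X x y t ω)) (κ y) P

/-- `Σ = lim_{t ↑ 1} ∫₀ᵗ σ²` is finite and `h(t) = σ²(t) / (Σ - ∫₀ᵗ σ²)` for `t ∈ [0, 1)`. -/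
def BridgeCondition (h σ : ℝ → ℝ) : Prop :=
  ∃ S : ℝ, Tendsto (fun t : ℝ ↦ ∫ r in (0 : ℝ)..t, σ r ^ 2) (𝓝[<] 1) (𝓝 S) ∧
    ∀ t ∈ Set.Ico (0 : ℝ) 1, h t = σ t ^ 2 / (S - ∫ r in (0 : ℝ)..t, σ r ^ 2)

end

end PinnedBridges

/-! Write `A t = ∫₀ᵗ σ²`, `V t = ∫₀ᵗ σ²/φ²`, so that `φ M` is a centred Gaussian process with
covariance `φ(s) φ(t) V(s)` for `s ≤ t`.

Necessity. The law of `X^{0y}` is that of `φ M` shifted by `(1 - φ) y`. If these are the bridges of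
`Z`, then for `Z` started in 0 the residual `Z_t - (1 - φ(t)) Z_1` is independent of `Z_1` and
distributed as `φ M` (`AreBridges.indepFun`). With `C = Var Z_1 > 0` this yields `cov(Z_t, Z_1) = (1
- φ(t)) C` and `cov(Z_s, Z_t) = φ(s) φ(t) V(s) + (1 - φ(s)) (1 - φ(t)) C`. A Gaussian Markov
covariance factorizes through intermediate times (`IsGaussianMarkov.covariance_mul_covariance`),
which forces `1/φ - 1 = c V` for a constant `c`. Differentiating, `-φ' = h φ = c σ²`, so `1 - φ = c
A`. Pinning gives `φ → 0` at 1, hence `A → 1/c = Σ` and `h = c σ²/φ = σ²/(Σ - A)`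
(`bridgeCondition_of_phi`).

Sufficiency. The condition integrates to `φ = 1 - A/Σ` and `V = Σ (1/φ - 1)`. For `N = ∫ σ dB` the
regression coefficient of `N_t` on `N_1` is `A(t)/Σ = 1 - φ(t)`; the residual is independent of
`N_1` and has the covariance of `φ M` (`covariance_bridge_eq`, `areBridges_of_hasRep`).

Continuous extension of `N` to time 1. By parts, `N_t = φ(t) M_t + ∫₀ᵗ M h φ dr`. The first term is
`X^{00}_t`, which tends to 0 by pinning; the integral converges absolutely almost surely, because
`E|M_r| ≤ √(Σ/φ(r))` and `∫ √(Σ/φ) (-dφ) ≤ 2√Σ` (`ae_intervalIntegrable_mul`).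

Wiener integrals are handled through the relation `HasRep`: the pair (random variable, integrand)
lies in the closed span of the pairs `(B_t, 1_{[0,t)})`. This relation is the graph of an isometry,
and all its random variables are jointly Gaussian. -/

namespace PinnedBridges

/-! ### The Wiener isometry as a closed graph in `L²(P) × L²(ℝ)`. -/

section WienerGraph

variable {Ω : Type*} [MeasurableSpace Ω] {P : Measure Ω} {B : ℝ≥0 → Ω → ℝ}

/-- The pair of the Brownian value `B t` and the indicator function of `[0, t)`. -/
noncomputable def wienerGenerator (hB : IsPreBrownianReal B P) (t : ℝ≥0) :
    Lp ℝ 2 P × Lp ℝ 2 (volume : Measure ℝ) :=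
  ((hB.isGaussianProcess.hasGaussianLaw_eval t).memLp_two.toLp (B t),
    indicatorConstLp 2 (measurableSet_Ico (a := (0 : ℝ)) (b := t)) (by simp) (1 : ℝ))

/-- The graph of the Wiener isometry: pairs `(∫ g dB, g)`. -/
noncomputable def wienerGraph (hB : IsPreBrownianReal B P) :
    Submodule ℝ (Lp ℝ 2 P × Lp ℝ 2 (volume : Measure ℝ)) :=
  (Submodule.span ℝ (Set.range (wienerGenerator hB))).topologicalClosure

/-- Both sides equal `min s t`: Brownian covariance on the left, length of `[0, s) ∩ [0, t)` on the
right. -/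
lemma inner_wienerGenerator (hB : IsPreBrownianReal B P) (s t : ℝ≥0) :
    inner ℝ (wienerGenerator hB s).1 (wienerGenerator hB t).1 =
      inner ℝ (wienerGenerator hB s).2 (wienerGenerator hB t).2 := by
  have := hB.isGaussianProcess.isProbabilityMeasure
  have hm (t : ℝ≥0) : MemLp (B t) 2 P := (hB.isGaussianProcess.hasGaussianLaw_eval t).memLp_two
  have h1 : inner ℝ (wienerGenerator hB s).1 (wienerGenerator hB t).1 = ((min s t : ℝ≥0) : ℝ) := by
    rw [← hB.covariance_eval, covariance_eq_sub (hm s) (hm t), hB.integral_eval, L2.inner_def]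
    simp only [zero_mul, sub_zero]
    refine integral_congr_ae ?_
    filter_upwards [(hm s).coeFn_toLp, (hm t).coeFn_toLp] with ω h1 h2
    simp only [wienerGenerator, h1, h2]
    simp [mul_comm]
  rw [h1]
  simp only [wienerGenerator]
  rw [L2.inner_indicatorConstLp_eq_inner_setIntegral]
  simp only [RCLike.inner_apply, conj_trivial, mul_one]
  have h2 : ∀ᵐ x ∂(volume.restrict (Set.Ico (0 : ℝ) s)),
      (indicatorConstLp 2 (measurableSet_Ico (a := (0 : ℝ)) (b := t)) (by simp) (1 : ℝ) :
        Lp ℝ 2 (volume : Measure ℝ)) x = (Set.Ico (0 : ℝ) t).indicator 1 x :=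
    ae_restrict_of_ae indicatorConstLp_coeFn
  rw [integral_congr_ae h2, integral_indicator_one measurableSet_Ico,
    measureReal_restrict_apply measurableSet_Ico, Set.Ico_inter_Ico]
  simp [min_comm]

lemma inner_eq_of_mem_span (hB : IsPreBrownianReal B P)
    {p q : Lp ℝ 2 P × Lp ℝ 2 (volume : Measure ℝ)}
    (hp : p ∈ Submodule.span ℝ (Set.range (wienerGenerator hB)))
    (hq : q ∈ Submodule.span ℝ (Set.range (wienerGenerator hB))) :
    inner ℝ p.1 q.1 = inner ℝ p.2 q.2 := by
  induction hp, hq using Submodule.span_induction₂ with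
  | mem_mem x y hx hy =>
    obtain ⟨s, rfl⟩ := hx
    obtain ⟨t, rfl⟩ := hy
    exact inner_wienerGenerator hB s t
  | zero_left => simp
  | zero_right => simp
  | add_left x y z _ _ _ h1 h2 => simp [inner_add_left, h1, h2]
  | add_right x y z _ _ _ h1 h2 => simp [inner_add_right, h1, h2]
  | smul_left r x y _ _ h => simp [real_inner_smul_left, h]
  | smul_right r x y _ _ h => simp [real_inner_smul_right, h]

/-- Equality of norms is a closed condition, so it passes from the span to its closure; polarization
then recovers inner products. -/
lemma norm_eq_of_mem_wienerGraph (hB : IsPreBrownianReal B P)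
    {p : Lp ℝ 2 P × Lp ℝ 2 (volume : Measure ℝ)} (hp : p ∈ wienerGraph hB) :
    ‖p.1‖ = ‖p.2‖ := by
  have hc : IsClosed {p : Lp ℝ 2 P × Lp ℝ 2 (volume : Measure ℝ) | ‖p.1‖ = ‖p.2‖} :=
    isClosed_eq (by fun_prop) (by fun_prop)
  refine closure_minimal (fun q hq ↦ ?_) hc hp
  have := inner_eq_of_mem_span hB hq hq
  rw [real_inner_self_eq_norm_sq, real_inner_self_eq_norm_sq] at this
  exact (sq_eq_sq₀ (norm_nonneg _) (norm_nonneg _)).1 this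

lemma inner_eq_of_mem_wienerGraph (hB : IsPreBrownianReal B P)
    {p q : Lp ℝ 2 P × Lp ℝ 2 (volume : Measure ℝ)}
    (hp : p ∈ wienerGraph hB) (hq : q ∈ wienerGraph hB) :
    inner ℝ p.1 q.1 = inner ℝ p.2 q.2 := by
  rw [real_inner_eq_norm_add_mul_self_sub_norm_mul_self_sub_norm_mul_self_div_two,
    real_inner_eq_norm_add_mul_self_sub_norm_mul_self_sub_norm_mul_self_div_two,
    ← norm_eq_of_mem_wienerGraph hB hp, ← norm_eq_of_mem_wienerGraph hB hq,
    ← Prod.fst_add, ← Prod.snd_add, norm_eq_of_mem_wienerGraph hB (add_mem hp hq)]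

/-- `Y` is the Wiener integral `∫ g dB` of the square-integrable function `g`. -/
def HasRep (hB : IsPreBrownianReal B P) (Y : Ω → ℝ) (g : ℝ → ℝ) : Prop :=
  ∃ (hY : MemLp Y 2 P) (hg : MemLp g 2 volume), (hY.toLp Y, hg.toLp g) ∈ wienerGraph hB

variable {hB : IsPreBrownianReal B P} {Y Y' : Ω → ℝ} {g g' : ℝ → ℝ}

lemma HasRep.memLp (h : HasRep hB Y g) : MemLp Y 2 P := h.1

lemma HasRep.memLp_right (h : HasRep hB Y g) : MemLp g 2 volume := h.2.1

lemma HasRep.congr (h : HasRep hB Y g) (hY : Y =ᵐ[P] Y') (hg : g =ᵐ[volume] g') :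
    HasRep hB Y' g' := by
  obtain ⟨h1, h2, h3⟩ := h
  refine ⟨h1.ae_eq hY, h2.ae_eq hg, ?_⟩
  rwa [← MemLp.toLp_congr h1 _ hY, ← MemLp.toLp_congr h2 _ hg]

lemma HasRep.add (h : HasRep hB Y g) (h' : HasRep hB Y' g') : HasRep hB (Y + Y') (g + g') := by
  obtain ⟨h1, h2, h3⟩ := h
  obtain ⟨h1', h2', h3'⟩ := h'
  exact ⟨h1.add h1', h2.add h2', add_mem h3 h3'⟩

lemma HasRep.sub (h : HasRep hB Y g) (h' : HasRep hB Y' g') : HasRep hB (Y - Y') (g - g') := by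
  obtain ⟨h1, h2, h3⟩ := h
  obtain ⟨h1', h2', h3'⟩ := h'
  exact ⟨h1.sub h1', h2.sub h2', sub_mem h3 h3'⟩

lemma HasRep.smul (h : HasRep hB Y g) (c : ℝ) : HasRep hB (c • Y) (c • g) := by
  obtain ⟨h1, h2, h3⟩ := h
  exact ⟨h1.const_smul c, h2.const_smul c, Submodule.smul_mem _ c h3⟩

lemma hasRep_zero : HasRep hB (0 : Ω → ℝ) 0 :=
  ⟨MemLp.zero', MemLp.zero', (wienerGraph hB).zero_mem⟩

lemma HasRep.sum {ι : Type*} (s : Finset ι) {Y : ι → Ω → ℝ} {g : ι → ℝ → ℝ}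
    (h : ∀ i ∈ s, HasRep hB (Y i) (g i)) : HasRep hB (∑ i ∈ s, Y i) (∑ i ∈ s, g i) := by
  classical
  induction s using Finset.induction_on with
  | empty => simpa using hasRep_zero
  | insert a s ha ih =>
    rw [Finset.sum_insert ha, Finset.sum_insert ha]
    exact (h a (by simp)).add (ih fun i hi ↦ h i (by simp [hi]))

lemma hasRep_eval (hB : IsPreBrownianReal B P) (t : ℝ≥0) :
    HasRep hB (B t) ((Set.Ico (0 : ℝ) t).indicator 1) :=
  ⟨(hB.isGaussianProcess.hasGaussianLaw_eval t).memLp_two,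
    memLp_indicator_const 2 measurableSet_Ico 1 (by simp),
    Submodule.le_topologicalClosure _ (Submodule.subset_span ⟨t, rfl⟩)⟩

lemma HasRep.integral_mul (h : HasRep hB Y g) (h' : HasRep hB Y' g') :
    ∫ ω, Y ω * Y' ω ∂P = ∫ x, g x * g' x := by
  obtain ⟨h1, h2, h3⟩ := h
  obtain ⟨h1', h2', h3'⟩ := h'
  have := inner_eq_of_mem_wienerGraph hB h3 h3'
  rw [L2.inner_def, L2.inner_def] at this
  convert this using 1
  · refine integral_congr_ae ?_
    filter_upwards [h1.coeFn_toLp, h1'.coeFn_toLp] with ω h1 h2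
    simp [h1, h2, mul_comm]
  · refine integral_congr_ae ?_
    filter_upwards [h2.coeFn_toLp, h2'.coeFn_toLp] with ω h1 h2
    simp [h1, h2, mul_comm]

lemma HasRep.eLpNorm_eq (h : HasRep hB Y g) : eLpNorm Y 2 P = eLpNorm g 2 volume := by
  obtain ⟨h1, h2, h3⟩ := h
  have := norm_eq_of_mem_wienerGraph hB h3
  rw [Lp.norm_toLp, Lp.norm_toLp, ENNReal.toReal_eq_toReal_iff' h1.2.ne h2.2.ne] at this
  exact this

lemma HasRep.of_tendsto {Y : ℕ → Ω → ℝ} {g : ℕ → ℝ → ℝ} {Y' : Ω → ℝ} {g' : ℝ → ℝ}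
    (h : ∀ n, HasRep hB (Y n) (g n)) (hY' : MemLp Y' 2 P) (hg' : MemLp g' 2 volume)
    (hY : Tendsto (fun n ↦ eLpNorm (Y n - Y') 2 P) atTop (𝓝 0))
    (hg : Tendsto (fun n ↦ eLpNorm (g n - g') 2 volume) atTop (𝓝 0)) :
    HasRep hB Y' g' := by
  refine ⟨hY', hg', ?_⟩
  have hc : IsClosed (wienerGraph hB : Set (Lp ℝ 2 P × Lp ℝ 2 (volume : Measure ℝ))) :=
    Submodule.isClosed_topologicalClosure _
  refine hc.mem_of_tendsto (Tendsto.prodMk_nhds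
    ((Lp.tendsto_Lp_iff_tendsto_eLpNorm'' Y (fun n ↦ (h n).1) Y' hY').2 hY)
    ((Lp.tendsto_Lp_iff_tendsto_eLpNorm'' g (fun n ↦ (h n).2.1) g' hg').2 hg))
    (Eventually.of_forall fun n ↦ (h n).2.2)

/-- For limits known only pathwise. The isometry turns convergence of the integrands into an `L²`
Cauchy property of the variables, and the `L²` limit agrees with the pathwise one along a
subsequence. -/
lemma HasRep.of_tendsto_ae {Y : ℕ → Ω → ℝ} {g : ℕ → ℝ → ℝ} {Y' : Ω → ℝ} {g' : ℝ → ℝ}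
    (h : ∀ n, HasRep hB (Y n) (g n)) (hg' : MemLp g' 2 volume)
    (hY : ∀ᵐ ω ∂P, Tendsto (fun n ↦ Y n ω) atTop (𝓝 (Y' ω)))
    (hg : Tendsto (fun n ↦ eLpNorm (g n - g') 2 volume) atTop (𝓝 0)) :
    HasRep hB Y' g' := by
  have hgL := (Lp.tendsto_Lp_iff_tendsto_eLpNorm'' g (fun n ↦ (h n).2.1) g' hg').2 hg
  have hYc : CauchySeq fun n ↦ (h n).1.toLp (Y n) := by
    refine Metric.cauchySeq_iff.2 fun ε hε ↦ ?_
    obtain ⟨N, hN⟩ := Metric.cauchySeq_iff.1 hgL.cauchySeq ε hε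
    refine ⟨N, fun m hm n hn ↦ ?_⟩
    have := norm_eq_of_mem_wienerGraph hB (sub_mem (h m).2.2 (h n).2.2)
    rw [dist_eq_norm, show (h m).1.toLp (Y m) - (h n).1.toLp (Y n) =
      (((h m).1.toLp (Y m), (h m).2.1.toLp (g m)) - ((h n).1.toLp (Y n),
        (h n).2.1.toLp (g n))).1 from rfl, this]
    simpa [dist_eq_norm] using hN m hm n hn
  obtain ⟨Z, hZ⟩ := cauchySeq_tendsto_of_complete hYc
  have hae : Z =ᵐ[P] Y' := by
    obtain ⟨ns, hns, hns'⟩ := (tendstoInMeasure_of_tendsto_Lp hZ).exists_seq_tendsto_ae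
    have hall : ∀ᵐ ω ∂P, ∀ n, (h n).1.toLp (Y n) ω = Y n ω :=
      ae_all_iff.2 fun n ↦ (h n).1.coeFn_toLp
    filter_upwards [hns', hY, hall] with ω h1 h2 h3
    simp only [h3] at h1
    exact tendsto_nhds_unique h1 (h2.comp hns.tendsto_atTop)
  have hZ' : HasRep hB Z g' := by
    refine ⟨Lp.memLp Z, hg', ?_⟩
    have hc : IsClosed (wienerGraph hB : Set (Lp ℝ 2 P × Lp ℝ 2 (volume : Measure ℝ))) :=
      Submodule.isClosed_topologicalClosure _
    rw [Lp.toLp_coeFn]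
    exact hc.mem_of_tendsto (hZ.prodMk_nhds hgL) (Eventually.of_forall fun n ↦ (h n).2.2)
  exact hZ'.congr hae .rfl

end WienerGraph

/-! ### Gaussian laws and covariances of Wiener integrals. -/

section Gaussian

variable {Ω : Type*} [MeasurableSpace Ω] {P : Measure Ω} {B : ℝ≥0 → Ω → ℝ}

lemma integral_sq_eq_norm_sq_toLp {Y : Ω → ℝ} (hY : MemLp Y 2 P) :
    ∫ ω, Y ω ^ 2 ∂P = ‖hY.toLp Y‖ ^ 2 := by
  rw [← real_inner_self_eq_norm_sq, L2.inner_def]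
  refine integral_congr_ae ?_
  filter_upwards [hY.coeFn_toLp] with ω h1
  simp [h1, sq]

lemma integral_cexp_of_hasGaussianLaw {Y : Ω → ℝ} (hY : HasGaussianLaw Y P) (h0 : ∫ ω, Y ω ∂P = 0)
    (u : ℝ) :
    ∫ ω, Complex.exp (u * Y ω * Complex.I) ∂P
      = Complex.exp (-(u ^ 2 * (∫ ω, Y ω ^ 2 ∂P : ℝ) / 2)) := by
  have h1 := charFun_apply_real (μ := P.map Y) u
  rw [integral_map hY.aemeasurable (by fun_prop)] at h1
  rw [← h1, hY.map_eq_gaussianReal, charFun_gaussianReal, h0,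
    variance_of_integral_eq_zero hY.aemeasurable h0, Real.coe_toNNReal _ (by positivity)]
  congr 1
  push_cast
  ring

lemma integral_cexp_of_mem_span (hB : IsPreBrownianReal B P)
    {p : Lp ℝ 2 P × Lp ℝ 2 (volume : Measure ℝ)}
    (hp : p ∈ Submodule.span ℝ (Set.range (wienerGenerator hB))) (u : ℝ) :
    ∫ ω, Complex.exp (u * p.1 ω * Complex.I) ∂P = Complex.exp (-(u ^ 2 * ‖p.1‖ ^ 2 / 2)) := by
  obtain ⟨c, rfl⟩ := Finsupp.mem_span_range_iff_exists_finsupp.1 hp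
  set Y : Ω → ℝ := fun ω ↦ ∑ t ∈ c.support, c t • B t ω with hY_def
  have hYG : HasGaussianLaw Y P :=
    (hB.isGaussianProcess.smul c).hasGaussianLaw_fun_sum (I := c.support)
  have hY0 : ∫ ω, Y ω ∂P = 0 := by
    rw [hY_def, integral_finsetSum _ fun t _ ↦ by exact (hB.integrable_eval t).smul (c t)]
    simp [integral_const_mul, hB.integral_eval]
  have hYp : (c.sum fun t a ↦ a • wienerGenerator hB t).1 = hYG.memLp_two.toLp Y := by
    rw [Finsupp.sum, Prod.fst_sum]
    refine Lp.ext ((Lp.coeFn_finsetSum _ _).trans ?_)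
    have h1 : ∀ᵐ ω ∂P, ∀ t ∈ c.support, (c t • wienerGenerator hB t).1 ω = c t * B t ω := by
      refine (ae_ball_iff (Finset.countable_toSet c.support)).2 fun t _ ↦ ?_
      filter_upwards [Lp.coeFn_smul (c t) (wienerGenerator hB t).1,
        (hB.isGaussianProcess.hasGaussianLaw_eval t).memLp_two.coeFn_toLp] with ω h1 h2
      rw [Prod.smul_fst, h1, Pi.smul_apply, wienerGenerator, h2, smul_eq_mul]
    filter_upwards [h1, hYG.memLp_two.coeFn_toLp] with ω h1 h2
    rw [h2, Finset.sum_apply]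
    exact Finset.sum_congr rfl h1
  rw [hYp]
  have := integral_cexp_of_hasGaussianLaw hYG hY0 u
  rw [integral_sq_eq_norm_sq_toLp hYG.memLp_two] at this
  push_cast at this
  rw [← this]
  refine integral_congr_ae ?_
  filter_upwards [hYG.memLp_two.coeFn_toLp] with ω h
  rw [h]

variable {hB : IsPreBrownianReal B P} {Y Y' : Ω → ℝ} {g g' : ℝ → ℝ}

/-- Finite combinations of Brownian values have this characteristic function; along an approximating
sequence in the span, dominated convergence (a.e. on a subsequence) carries it to the closure. -/
lemma HasRep.integral_cexp (h : HasRep hB Y g) (u : ℝ) :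
    ∫ ω, Complex.exp (u * Y ω * Complex.I) ∂P
      = Complex.exp (-(u ^ 2 * (∫ ω, Y ω ^ 2 ∂P : ℝ) / 2)) := by
  have := hB.isGaussianProcess.isProbabilityMeasure
  obtain ⟨h1, h2, h3⟩ := h
  rw [integral_sq_eq_norm_sq_toLp h1]
  obtain ⟨p, hp, hpt⟩ := mem_closure_iff_seq_limit.1
    (show (h1.toLp Y, h2.toLp g) ∈
      closure (Submodule.span ℝ (Set.range (wienerGenerator hB)) : Set _) from h3)
  have hpt1 : Tendsto (fun n ↦ (p n).1) atTop (𝓝 (h1.toLp Y)) :=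
    (continuous_fst.tendsto _).comp hpt
  obtain ⟨ns, hns, hae⟩ := (tendstoInMeasure_of_tendsto_Lp hpt1).exists_seq_tendsto_ae
  have hl : Tendsto (fun n ↦ ∫ ω, Complex.exp (u * (p (ns n)).1 ω * Complex.I) ∂P) atTop
      (𝓝 (∫ ω, Complex.exp (u * Y ω * Complex.I) ∂P)) := by
    refine tendsto_integral_of_dominated_convergence (fun _ ↦ 1) (fun n ↦ ?_)
      (integrable_const _) (fun n ↦ ?_) ?_
    · have := (Lp.aestronglyMeasurable (p (ns n)).1).aemeasurable
      exact (by fun_prop : AEMeasurable _ _).aestronglyMeasurable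
    · refine Eventually.of_forall fun ω ↦ ?_
      rw [← Complex.ofReal_mul, Complex.norm_exp_ofReal_mul_I]
    · filter_upwards [hae, h1.coeFn_toLp] with ω h1 h2
      rw [h2] at h1
      have hc : Continuous fun x : ℝ ↦ Complex.exp (u * x * Complex.I) := by fun_prop
      exact (hc.tendsto _).comp h1
  have hr : Tendsto (fun n ↦ Complex.exp (-(u ^ 2 * ‖(p (ns n)).1‖ ^ 2 / 2))) atTop
      (𝓝 (Complex.exp (-(u ^ 2 * ‖h1.toLp Y‖ ^ 2 / 2)))) := by
    have hc : Continuous fun Z : Lp ℝ 2 P ↦ Complex.exp (-(u ^ 2 * ‖Z‖ ^ 2 / 2)) := by fun_prop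
    exact (hc.tendsto _).comp (hpt1.comp hns.tendsto_atTop)
  simp only [integral_cexp_of_mem_span hB (hp _)] at hl
  rw [tendsto_nhds_unique hl hr]
  push_cast
  rfl

lemma HasRep.hasLaw (h : HasRep hB Y g) :
    HasLaw Y (gaussianReal 0 (∫ x, g x ^ 2).toNNReal) P := by
  have := hB.isGaussianProcess.isProbabilityMeasure
  have hY := h.memLp.aemeasurable
  refine ⟨hY, Measure.ext_of_charFun (funext fun u ↦ ?_)⟩
  have h2 := h.integral_mul h
  simp only [← sq] at h2
  rw [charFun_apply_real, integral_map hY (by fun_prop), h.integral_cexp, charFun_gaussianReal,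
    h2, Real.coe_toNNReal _ (by positivity)]
  congr 1
  push_cast
  ring

lemma HasRep.integral_eq_zero (h : HasRep hB Y g) : ∫ ω, Y ω ∂P = 0 := by
  rw [h.hasLaw.integral_eq, integral_id_gaussianReal]

lemma HasRep.covariance_eq (h : HasRep hB Y g) (h' : HasRep hB Y' g') :
    cov[Y, Y'; P] = ∫ x, g x * g' x := by
  have := hB.isGaussianProcess.isProbabilityMeasure
  rw [covariance_eq_sub h.memLp h'.memLp, h.integral_eq_zero, ← h.integral_mul h']
  simp

lemma HasRep.variance_eq (h : HasRep hB Y g) : variance Y P = ∫ x, g x ^ 2 := by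
  rw [← covariance_self h.memLp.aemeasurable, h.covariance_eq h]
  simp only [sq]

lemma HasRep.ae_eq (h : HasRep hB Y g) (h' : HasRep hB Y' g) : Y =ᵐ[P] Y' := by
  have h1 := (h.sub h').eLpNorm_eq
  rw [sub_self, eLpNorm_zero, eLpNorm_eq_zero_iff (h.sub h').memLp.1 (by simp)] at h1
  filter_upwards [h1] with ω hω
  simpa [sub_eq_zero] using hω

lemma sum_smul_apply_single {ι : Type*} [Fintype ι] [DecidableEq ι] (L : (ι → ℝ) →L[ℝ] ℝ)
    (z : ι → ℝ) : L z = ∑ i, L (Pi.single i 1) * z i := by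
  conv_lhs => rw [← Finset.univ_sum_single z, map_sum]
  refine Finset.sum_congr rfl fun i _ ↦ ?_
  rw [mul_comm, ← smul_eq_mul, ← map_smul, ← Pi.single_smul, smul_eq_mul, mul_one]

lemma hasRep_strongDual {ι : Type*} [Fintype ι] [DecidableEq ι] {Y : ι → Ω → ℝ} {g : ι → ℝ → ℝ}
    (h : ∀ i, HasRep hB (Y i) (g i)) (L : (ι → ℝ) →L[ℝ] ℝ) :
    HasRep hB (fun ω ↦ L fun i ↦ Y i ω) (fun x ↦ L fun i ↦ g i x) := by
  have := HasRep.sum Finset.univ fun i _ ↦ (h i).smul (L (Pi.single i 1))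
  convert this using 1
  · ext ω
    rw [sum_smul_apply_single]
    simp
  · ext x
    rw [sum_smul_apply_single]
    simp

/-- Every linear functional of the family is again a Wiener integral, hence Gaussian (Cramér–Wold).
-/
lemma hasGaussianLaw_of_hasRep {ι : Type*} [Fintype ι] {Y : ι → Ω → ℝ} {g : ι → ℝ → ℝ}
    (h : ∀ i, HasRep hB (Y i) (g i)) : HasGaussianLaw (fun ω i ↦ Y i ω) P := by
  classical
  refine ⟨isGaussian_of_map_eq_gaussianReal fun L ↦
    ⟨0, (∫ x, (L fun i ↦ g i x) ^ 2).toNNReal, ?_⟩⟩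
  rw [AEMeasurable.map_map_of_aemeasurable (by fun_prop)
    (aemeasurable_pi_lambda _ fun i ↦ (h i).memLp.aemeasurable)]
  exact (hasRep_strongDual h L).hasLaw.map_eq

/-- Two finite families of Wiener integrals with the same covariances have the same law. -/
lemma map_eq_of_hasRep {ι : Type*} [Fintype ι] {Y Y' : ι → Ω → ℝ} {g g' : ι → ℝ → ℝ}
    (h : ∀ i, HasRep hB (Y i) (g i)) (h' : ∀ i, HasRep hB (Y' i) (g' i))
    (hcov : ∀ i j, ∫ x, g i x * g j x = ∫ x, g' i x * g' j x) :
    P.map (fun ω i ↦ Y i ω) = P.map (fun ω i ↦ Y' i ω) := by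
  classical
  have := hB.isGaussianProcess.isProbabilityMeasure
  have hm : AEMeasurable (fun ω i ↦ Y i ω) P :=
    aemeasurable_pi_lambda _ fun i ↦ (h i).memLp.aemeasurable
  have hm' : AEMeasurable (fun ω i ↦ Y' i ω) P :=
    aemeasurable_pi_lambda _ fun i ↦ (h' i).memLp.aemeasurable
  refine Measure.ext_of_charFunDual (funext fun L ↦ ?_)
  -- The variance of a linear functional is a quadratic form in the covariances alone, so it is the
  -- same for both families.
  have key : ∀ {Z : ι → Ω → ℝ} {k : ι → ℝ → ℝ}, (∀ i, HasRep hB (Z i) (k i)) →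
      ∫ x, (L fun i ↦ k i x) ^ 2 = ∑ i, ∑ j, L (Pi.single i 1) * L (Pi.single j 1) *
        ∫ x, k i x * k j x := by
    intro Z k hk
    have hint (i j) : Integrable (fun x ↦ k i x * k j x) :=
      (hk i).memLp_right.integrable_mul (hk j).memLp_right
    have hsq (x : ℝ) : (L fun i ↦ k i x) ^ 2 =
        ∑ i, ∑ j, L (Pi.single i 1) * L (Pi.single j 1) * (k i x * k j x) := by
      rw [sum_smul_apply_single L, sq, Finset.sum_mul_sum]
      refine Finset.sum_congr rfl fun i _ ↦ Finset.sum_congr rfl fun j _ ↦ by ring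
    simp_rw [hsq, ← integral_const_mul]
    rw [integral_finsetSum _ fun i _ ↦ integrable_finsetSum _ fun j _ ↦ (hint i j).const_mul _]
    exact Finset.sum_congr rfl fun i _ ↦ integral_finsetSum _ fun j _ ↦ (hint i j).const_mul _
  rw [charFunDual_apply, charFunDual_apply, integral_map hm (by fun_prop),
    integral_map hm' (by fun_prop)]
  have h1 := (hasRep_strongDual h L).integral_cexp 1
  have h1' := (hasRep_strongDual h' L).integral_cexp 1
  simp only [Complex.ofReal_one, one_mul] at h1 h1'
  rw [h1, h1']
  have h2 := (hasRep_strongDual h L).integral_mul (hasRep_strongDual h L)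
  have h2' := (hasRep_strongDual h' L).integral_mul (hasRep_strongDual h' L)
  simp only [← sq] at h2 h2'
  rw [h2, h2', key h, key h']
  simp_rw [hcov]

end Gaussian

/-! ### Step functions on equidistant partitions. -/

section StepFunctions

/-- The points `t k / n` of the `n`-th equidistant partition of `[0, t]`. -/
noncomputable def grid (t : ℝ≥0) (n k : ℕ) : ℝ≥0 := t * (k : ℝ≥0) / (n : ℝ≥0)

/-- The step function with value `c k` on the `k`-th cell of the `n`-th partition of `[0, t)`. -/
noncomputable def stepFn (t : ℝ≥0) (n : ℕ) (c : ℕ → ℝ) (x : ℝ) : ℝ :=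
  ∑ k ∈ Finset.range n, c k * (Set.Ico (grid t n k : ℝ) (grid t n (k + 1))).indicator 1 x

variable {t : ℝ≥0} {n : ℕ}

lemma grid_zero (t : ℝ≥0) (n : ℕ) : grid t n 0 = 0 := by simp [grid]

lemma grid_self (t : ℝ≥0) (hn : n ≠ 0) : grid t n n = t := by
  rw [grid, mul_div_assoc, div_self (by exact_mod_cast hn), mul_one]

lemma grid_mono (t : ℝ≥0) (n : ℕ) : Monotone (grid t n) := by
  intro i j hij
  unfold grid
  gcongr

lemma grid_le (t : ℝ≥0) {k : ℕ} (hk : k ≤ n) : grid t n k ≤ t := by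
  rcases Nat.eq_zero_or_pos n with rfl | hn
  · simp [grid]
  · calc grid t n k ≤ grid t n n := grid_mono t n hk
      _ = t := grid_self t hn.ne'

lemma coe_grid_succ_sub (t : ℝ≥0) (n k : ℕ) : (grid t n (k + 1) : ℝ) - grid t n k = t / n := by
  simp only [grid]
  push_cast
  ring

lemma leftSum_eq_sum_grid {Ω : Type*} (f : ℝ → ℝ) (B : ℝ≥0 → Ω → ℝ) (t : ℝ≥0) (n : ℕ) (ω : Ω) :
    leftSum f B t n ω =
      ∑ k ∈ Finset.range n, f (grid t n k) * (B (grid t n (k + 1)) ω - B (grid t n k) ω) := by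
  simp [leftSum, grid]

lemma exists_mem_cell (hn : n ≠ 0) {x : ℝ} (hx : x ∈ Set.Ico (0 : ℝ) t) :
    ∃ k < n, x ∈ Set.Ico (grid t n k : ℝ) (grid t n (k + 1)) := by
  have hex : ∃ k, x < grid t n (k + 1) := by
    refine ⟨n - 1, ?_⟩
    rw [Nat.sub_add_cancel (Nat.pos_of_ne_zero hn), grid_self t hn]
    exact hx.2
  classical
  refine ⟨Nat.find hex, ?_, ?_, Nat.find_spec hex⟩
  · have : Nat.find hex ≤ n - 1 := by
      refine Nat.find_min' hex ?_
      rw [Nat.sub_add_cancel (Nat.pos_of_ne_zero hn), grid_self t hn]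
      exact hx.2
    omega
  · rcases Nat.eq_zero_or_pos (Nat.find hex) with h | h
    · rw [h, grid_zero]
      exact hx.1
    · have := Nat.find_min hex (Nat.sub_lt h one_pos)
      rwa [Nat.sub_add_cancel (show 1 ≤ Nat.find hex from h), not_lt] at this

lemma stepFn_eq_of_mem {k : ℕ} (hk : k < n) {x : ℝ}
    (hx : x ∈ Set.Ico (grid t n k : ℝ) (grid t n (k + 1))) (c : ℕ → ℝ) :
    stepFn t n c x = c k := by
  rw [stepFn, Finset.sum_eq_single_of_mem k (Finset.mem_range.2 hk), Set.indicator_of_mem hx]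
  · simp
  · intro j _ hj
    rw [Set.indicator_of_notMem, mul_zero]
    rintro ⟨h1, h2⟩
    rcases lt_or_gt_of_ne hj with h | h
    · have : (grid t n (j + 1) : ℝ) ≤ grid t n k := by exact_mod_cast grid_mono t n h
      linarith [hx.1]
    · have : (grid t n (k + 1) : ℝ) ≤ grid t n j := by exact_mod_cast grid_mono t n h
      linarith [hx.2]

lemma stepFn_eq_zero {x : ℝ} (hx : x ∉ Set.Ico (0 : ℝ) t) (c : ℕ → ℝ) : stepFn t n c x = 0 := by
  refine Finset.sum_eq_zero fun k hk ↦ ?_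
  rw [Set.indicator_of_notMem, mul_zero]
  intro h
  refine hx ⟨(grid t n k).2.trans h.1, h.2.trans_le ?_⟩
  exact_mod_cast grid_le t (Finset.mem_range.1 hk)

lemma eventually_abs_sub_le_of_cell {f : ℝ → ℝ} (hf : ContinuousOn f (Set.Icc 0 (t : ℝ)))
    {ε : ℝ} (hε : 0 < ε) :
    ∀ᶠ n : ℕ in atTop, ∀ k < n, ∀ x ∈ Set.Icc (grid t n k : ℝ) (grid t n (k + 1)),
      ∀ y ∈ Set.Icc (grid t n k : ℝ) (grid t n (k + 1)), |f x - f y| ≤ ε := by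
  have hu := isCompact_Icc.uniformContinuousOn_of_continuous hf
  obtain ⟨δ, hδ, h⟩ := Metric.uniformContinuousOn_iff.1 hu ε hε
  have hlim : Tendsto (fun n : ℕ ↦ (t : ℝ) / n) atTop (𝓝 0) :=
    tendsto_const_div_atTop_nhds_zero_nat _
  filter_upwards [hlim.eventually (gt_mem_nhds hδ)] with n hn k hk x hx y hy
  have hsub : Set.Icc (grid t n k : ℝ) (grid t n (k + 1)) ⊆ Set.Icc 0 (t : ℝ) := by
    refine Set.Icc_subset_Icc (grid t n k).2 ?_
    exact_mod_cast grid_le t hk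
  have := h x (hsub hx) y (hsub hy) ?_
  · exact this.le
  · have := coe_grid_succ_sub t n k
    rw [Real.dist_eq]
    refine lt_of_le_of_lt ?_ hn
    rw [abs_le]
    constructor <;> linarith [hx.1, hx.2, hy.1, hy.2]

/-- Step functions with nodes in the cells of the partitions converge uniformly. -/
lemma eventually_abs_stepFn_sub_le {f : ℝ → ℝ} (hf : ContinuousOn f (Set.Icc 0 (t : ℝ)))
    {z : ℕ → ℕ → ℝ} (hz : ∀ n k, z n k ∈ Set.Icc (grid t n k : ℝ) (grid t n (k + 1)))
    {ε : ℝ} (hε : 0 < ε) :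
    ∀ᶠ n : ℕ in atTop, ∀ x ∈ Set.Ico (0 : ℝ) t,
      |stepFn t n (fun k ↦ f (z n k)) x - f x| ≤ ε := by
  filter_upwards [eventually_abs_sub_le_of_cell hf hε, eventually_ne_atTop 0] with n hn hn0 x hx
  obtain ⟨k, hk, hxk⟩ := exists_mem_cell hn0 hx
  rw [stepFn_eq_of_mem hk hxk]
  exact hn k hk _ (hz n k) x ⟨hxk.1, hxk.2.le⟩

lemma left_mem_cell (t : ℝ≥0) (n k : ℕ) :
    (grid t n k : ℝ) ∈ Set.Icc (grid t n k : ℝ) (grid t n (k + 1)) :=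
  ⟨le_rfl, by exact_mod_cast grid_mono t n k.le_succ⟩

lemma right_mem_cell (t : ℝ≥0) (n k : ℕ) :
    (grid t n (k + 1) : ℝ) ∈ Set.Icc (grid t n k : ℝ) (grid t n (k + 1)) :=
  ⟨by exact_mod_cast grid_mono t n k.le_succ, le_rfl⟩

/-- On the bounded interval `[0, t)` uniform convergence dominates `L²` convergence. -/
lemma tendsto_eLpNorm_of_uniform {F : ℕ → ℝ → ℝ}
    (h0 : ∀ n, ∀ x ∉ Set.Ico (0 : ℝ) t, F n x = 0)
    (h : ∀ ε > 0, ∀ᶠ n in atTop, ∀ x ∈ Set.Ico (0 : ℝ) t, |F n x| ≤ ε) :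
    Tendsto (fun n ↦ eLpNorm (F n) 2 volume) atTop (𝓝 0) := by
  rw [ENNReal.tendsto_nhds_zero]
  intro ε hε
  set V : ℝ≥0∞ := volume (Set.Ico (0 : ℝ) t) ^ ((2 : ℝ≥0∞).toReal⁻¹)
  have hV : V ≠ ∞ := by simp [V]
  obtain ⟨δ, hδ, hδε⟩ : ∃ δ : ℝ≥0, 0 < δ ∧ V * δ ≤ ε := by
    have hc : Tendsto (fun δ : ℝ≥0 ↦ V * (δ : ℝ≥0∞)) (𝓝[>] 0) (𝓝 0) := by
      have h1 : Tendsto (fun δ : ℝ≥0 ↦ V * (δ : ℝ≥0∞)) (𝓝 0) (𝓝 (V * ((0 : ℝ≥0) : ℝ≥0∞))) :=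
        ENNReal.Tendsto.const_mul (ENNReal.tendsto_coe.2 tendsto_id) (.inr hV)
      rw [ENNReal.coe_zero, mul_zero] at h1
      exact h1.mono_left nhdsWithin_le_nhds
    obtain ⟨δ, h1, h2⟩ := ((ENNReal.tendsto_nhds_zero.1 hc ε hε).and self_mem_nhdsWithin).exists
    exact ⟨δ, h2, h1⟩
  filter_upwards [h δ hδ] with n hn
  have hF : F n = (Set.Ico (0 : ℝ) t).indicator (F n) := by
    ext x
    by_cases hx : x ∈ Set.Ico (0 : ℝ) t
    · rw [Set.indicator_of_mem hx]
    · rw [Set.indicator_of_notMem hx, h0 n x hx]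
  rw [hF, eLpNorm_indicator_eq_eLpNorm_restrict measurableSet_Ico]
  refine (eLpNorm_le_of_ae_bound (C := δ) ?_).trans ?_
  · filter_upwards [ae_restrict_mem measurableSet_Ico] with x hx using hn x hx
  · rw [Measure.restrict_apply_univ, ENNReal.ofReal_coe_nnreal]
    exact hδε

lemma memLp_indicator_of_continuousOn {f : ℝ → ℝ} (hf : ContinuousOn f (Set.Icc 0 (t : ℝ))) :
    MemLp ((Set.Ico (0 : ℝ) t).indicator f) 2 volume := by
  rw [memLp_indicator_iff_restrict measurableSet_Ico]
  obtain ⟨C, hC⟩ := isCompact_Icc.exists_bound_of_continuousOn hf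
  refine MemLp.of_bound ((hf.mono Set.Ico_subset_Icc_self).aestronglyMeasurable
    measurableSet_Ico) C ?_
  filter_upwards [ae_restrict_mem measurableSet_Ico] with x hx
    using hC x (Set.Ico_subset_Icc_self hx)

end StepFunctions

/-! ### From left-endpoint sums to `HasRep` and back. -/

section WienerIntegral

variable {Ω : Type*} [MeasurableSpace Ω] {P : Measure Ω} {B M : ℝ≥0 → Ω → ℝ}
  {hB : IsPreBrownianReal B P} {f q : ℝ → ℝ} {t : ℝ≥0}

/-- Serves two purposes: `q = 1` gives the sums defining the Wiener integral, `q = σ / φ` those used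
for integration by parts. -/
lemma hasRep_sum_increments (hM : ∀ s ≤ t, HasRep hB (M s) ((Set.Ico (0 : ℝ) s).indicator q))
    (n : ℕ) (c : ℕ → ℝ) :
    HasRep hB (fun ω ↦ ∑ k ∈ Finset.range n,
        c k * (M (grid t n (k + 1)) ω - M (grid t n k) ω))
      (fun x ↦ stepFn t n c x * q x) := by
  have := HasRep.sum (Finset.range n) fun k hk ↦
    ((hM _ (grid_le t (Finset.mem_range.1 hk))).sub
      (hM _ (grid_le t (Finset.mem_range.1 hk).le))).smul (c k)
  convert this using 1
  · ext ω
    simp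
  · ext x
    simp only [stepFn, Finset.sum_mul, Finset.sum_apply, Pi.smul_apply, Pi.sub_apply, smul_eq_mul]
    refine Finset.sum_congr rfl fun k _ ↦ ?_
    rw [mul_assoc]
    congr 1
    have hle : (grid t n k : ℝ) ≤ grid t n (k + 1) := by exact_mod_cast grid_mono t n k.le_succ
    have h0 : (0 : ℝ) ≤ grid t n k := (grid t n k).2
    simp only [Set.indicator_apply, Set.mem_Ico]
    split_ifs <;> simp <;> exfalso <;> grind

lemma tendsto_eLpNorm_stepFn_mul (hf : ContinuousOn f (Set.Icc 0 (t : ℝ)))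
    (hq : ContinuousOn q (Set.Icc 0 (t : ℝ)))
    {z : ℕ → ℕ → ℝ} (hz : ∀ n k, z n k ∈ Set.Icc (grid t n k : ℝ) (grid t n (k + 1))) :
    Tendsto (fun n ↦ eLpNorm ((fun x ↦ stepFn t n (fun k ↦ f (z n k)) x * q x) -
      (Set.Ico (0 : ℝ) t).indicator (fun x ↦ f x * q x)) 2 volume) atTop (𝓝 0) := by
  refine tendsto_eLpNorm_of_uniform (t := t) (fun n x hx ↦ ?_) fun ε hε ↦ ?_
  · simp [stepFn_eq_zero hx, Set.indicator_of_notMem hx]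
  · obtain ⟨C, hC⟩ := isCompact_Icc.exists_bound_of_continuousOn hq
    have hC' : 0 < |C| + 1 := by positivity
    filter_upwards [eventually_abs_stepFn_sub_le hf hz (div_pos hε hC')] with n hn x hx
    have h1 := hn x hx
    have h2 : |q x| ≤ |C| + 1 := by
      have := hC x (Set.Ico_subset_Icc_self hx)
      rw [Real.norm_eq_abs] at this
      linarith [le_abs_self C]
    rw [Pi.sub_apply, Set.indicator_of_mem hx, ← sub_mul, abs_mul]
    calc _ ≤ ε / (|C| + 1) * (|C| + 1) := by gcongr
      _ = ε := by field_simp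

lemma HasRep.tendsto_eLpNorm_sub {Y : ℕ → Ω → ℝ} {g : ℕ → ℝ → ℝ} {Y' : Ω → ℝ} {g' : ℝ → ℝ}
    (h : ∀ n, HasRep hB (Y n) (g n)) (h' : HasRep hB Y' g')
    (hg : Tendsto (fun n ↦ eLpNorm (g n - g') 2 volume) atTop (𝓝 0)) :
    Tendsto (fun n ↦ eLpNorm (Y n - Y') 2 P) atTop (𝓝 0) := by
  simpa only [((h _).sub h').eLpNorm_eq] using hg

lemma hasRep_leftSum (hB : IsPreBrownianReal B P) (f : ℝ → ℝ) (t : ℝ≥0) (n : ℕ) :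
    HasRep hB (leftSum f B t n) (fun x ↦ stepFn t n (fun k ↦ f (grid t n k)) x * 1) := by
  have := hasRep_sum_increments (t := t) (q := fun _ ↦ 1) (fun s _ ↦ hasRep_eval hB s) n
    (fun k ↦ f (grid t n k))
  convert this using 1
  exact funext fun ω ↦ leftSum_eq_sum_grid f B t n ω

lemma continuousOn_Icc_of_lt (hf : ContinuousOn f (Set.Ico 0 1)) (ht : t < 1) :
    ContinuousOn f (Set.Icc 0 (t : ℝ)) :=
  hf.mono fun _ hx ↦ ⟨hx.1, hx.2.trans_lt (by exact_mod_cast ht)⟩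

lemma IsWienerIntegral.hasRep (hM : IsWienerIntegral f B M P) (hB : IsPreBrownianReal B P)
    (hf : ContinuousOn f (Set.Ico 0 1)) (ht : t < 1) :
    HasRep hB (M t) ((Set.Ico (0 : ℝ) t).indicator f) := by
  have hft := continuousOn_Icc_of_lt hf ht
  refine HasRep.of_tendsto (hasRep_leftSum hB f t) (hM.memLp t ht)
    (memLp_indicator_of_continuousOn hft) (hM.tendsto t ht) ?_
  simpa using tendsto_eLpNorm_stepFn_mul (q := fun _ ↦ 1) hft continuousOn_const
    (left_mem_cell t)

lemma isWienerIntegral_of_hasRep (hf : ContinuousOn f (Set.Ico 0 1))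
    (hM : ∀ t : ℝ≥0, t < 1 → HasRep hB (M t) ((Set.Ico (0 : ℝ) t).indicator f))
    (hc : ∀ᵐ ω ∂P, ContinuousOn (fun t ↦ M t ω) (Set.Iio 1)) :
    IsWienerIntegral f B M P where
  memLp t ht := (hM t ht).memLp
  tendsto t ht := by
    refine HasRep.tendsto_eLpNorm_sub (hasRep_leftSum hB f t) (hM t ht) ?_
    simpa using tendsto_eLpNorm_stepFn_mul (q := fun _ ↦ 1) (continuousOn_Icc_of_lt hf ht)
      continuousOn_const (left_mem_cell t)
  continuous := hc

lemma integral_indicator_Ico_mul_indicator (f : ℝ → ℝ) {s t : ℝ≥0} (hst : s ≤ t) :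
    ∫ x, (Set.Ico (0 : ℝ) s).indicator f x * (Set.Ico (0 : ℝ) t).indicator f x
      = ∫ x in (0 : ℝ)..s, f x ^ 2 := by
  rw [intervalIntegral.integral_of_le s.coe_nonneg, ← integral_Ico_eq_integral_Ioc,
    ← integral_indicator measurableSet_Ico]
  congr 1 with x
  have hst' : (s : ℝ) ≤ t := by exact_mod_cast hst
  simp only [Set.indicator_apply, Set.mem_Ico]
  split_ifs <;> grind

end WienerIntegral

/-! ### Conditional laws of the form "shift plus independent noise". -/

section ShiftKernel

variable {V E R : Type*} [MeasurableSpace V] [MeasurableSpace E] [MeasurableSpace R]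
  [AddCommGroup E] [MeasurableAdd₂ E]

/-- The kernel sending `v` to the law of `ψ v + W`, where `W` has law `ν`. -/
noncomputable def shiftKernel (ν : Measure E) [SFinite ν] (ψ : V → E) (hψ : Measurable ψ) :
    Kernel V E :=
  (Kernel.deterministic ψ hψ ×ₖ Kernel.const V ν).map fun p ↦ p.1 + p.2

lemma shiftKernel_apply (ν : Measure E) [SFinite ν] {ψ : V → E} (hψ : Measurable ψ) (v : V) :
    shiftKernel ν ψ hψ v = ν.map (fun w ↦ ψ v + w) := by
  rw [shiftKernel, Kernel.map_apply _ (by fun_prop), Kernel.prod_apply, Kernel.deterministic_apply,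
    Kernel.const_apply, Measure.dirac_prod, Measure.map_map (by fun_prop) (by fun_prop)]
  rfl

instance (ν : Measure E) [IsProbabilityMeasure ν] (ψ : V → E) (hψ : Measurable ψ) :
    IsMarkovKernel (shiftKernel ν ψ hψ) :=
  Kernel.IsMarkovKernel.map _ (by fun_prop)

lemma compProd_shiftKernel (μ : Measure V) [SFinite μ] (ν : Measure E) [IsProbabilityMeasure ν]
    {ψ : V → E} (hψ : Measurable ψ) :
    μ ⊗ₘ shiftKernel ν ψ hψ = (μ.prod ν).map (fun p ↦ (p.1, ψ p.1 + p.2)) := by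
  ext s hs
  rw [Measure.compProd_apply hs, Measure.map_apply (by fun_prop) hs,
    Measure.prod_apply (by measurability)]
  refine lintegral_congr fun v ↦ ?_
  rw [shiftKernel_apply, Measure.map_apply (by fun_prop) (measurable_prodMk_left hs)]
  rfl

variable {Ω : Type*} [MeasurableSpace Ω] {P : Measure Ω} [IsProbabilityMeasure P]
  {X : Ω → V} {Y : Ω → E} {ν : Measure E} [IsProbabilityMeasure ν] {ψ : V → E}

/-- Together with `HasCondDistrib.indepFun_sub`, this translates statements about conditional laws
into independence of residuals. Transition kernels (`ψ = id`) and bridges (`ψ y = (1 - φ) y`) both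
have this shape. -/
lemma hasCondDistrib_shiftKernel (hψ : Measurable ψ) (hX : AEMeasurable X P)
    (hW : HasLaw (fun ω ↦ Y ω - ψ (X ω)) ν P) (hind : IndepFun X (fun ω ↦ Y ω - ψ (X ω)) P) :
    HasCondDistrib Y X (shiftKernel ν ψ hψ) P := by
  rw [HasCondDistrib, compProd_shiftKernel]
  have h1 := hind.hasLaw_prod ⟨hX, rfl⟩ hW
  have h2 : HasLaw (fun p : V × E ↦ (p.1, ψ p.1 + p.2))
    (((P.map X).prod ν).map (fun p ↦ (p.1, ψ p.1 + p.2))) ((P.map X).prod ν) :=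
    ⟨by fun_prop, rfl⟩
  simpa using h2.fun_comp h1

variable [MeasurableSub₂ E]

lemma HasCondDistrib.indepFun_sub (hψ : Measurable ψ)
    (h : HasCondDistrib Y X (shiftKernel ν ψ hψ) P) :
    HasLaw (fun ω ↦ Y ω - ψ (X ω)) ν P ∧ IndepFun X (fun ω ↦ Y ω - ψ (X ω)) P := by
  have hX := HasCondDistrib.aemeasurable_fst h
  have : IsProbabilityMeasure (P.map X) := Measure.isProbabilityMeasure_map hX
  rw [HasCondDistrib, compProd_shiftKernel] at h
  have h2 : HasLaw (fun p : V × E ↦ (p.1, p.2 - ψ p.1)) ((P.map X).prod ν)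
      (((P.map X).prod ν).map (fun p ↦ (p.1, ψ p.1 + p.2))) := by
    refine ⟨by fun_prop, ?_⟩
    rw [Measure.map_map (by fun_prop) (by fun_prop)]
    convert Measure.map_id
    ext p <;> simp
  have h3 : HasLaw (fun ω ↦ (X ω, Y ω - ψ (X ω))) ((P.map X).prod ν) P := h2.fun_comp h
  have h4 : HasLaw (fun ω ↦ Y ω - ψ (X ω)) ν P := by
    have : HasLaw (Prod.snd : V × E → E) ν ((P.map X).prod ν) :=
      ⟨by fun_prop, by simp⟩
    exact this.fun_comp h3
  exact ⟨h4, (indepFun_iff_hasLaw_prodMk_prod ⟨hX, rfl⟩ h4).2 h3⟩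

/-- If the conditional law of `Y` given `(X, Z)` depends on `X` only and `Y - ψ X` is independent
of `X`, then `Y - ψ X` is independent of `(X, Z)`. -/
lemma indepFun_prodMk_of_hasCondDistrib_prodMkRight [StandardBorelSpace E] [Nonempty E]
    {Z : Ω → R} {κ : Kernel V E} [IsMarkovKernel κ]
    (hψ : Measurable ψ) (h : HasCondDistrib Y (fun ω ↦ (X ω, Z ω)) (Kernel.prodMkRight R κ) P)
    (hind : IndepFun X (fun ω ↦ Y ω - ψ (X ω)) P) :
    IndepFun (fun ω ↦ (X ω, Z ω)) (fun ω ↦ Y ω - ψ (X ω)) P := by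
  have hXZ := HasCondDistrib.aemeasurable_fst h
  have hX : AEMeasurable X P := hXZ.fst
  have hY := HasCondDistrib.aemeasurable_snd h
  have hW : AEMeasurable (fun ω ↦ Y ω - ψ (X ω)) P := hY.sub (hψ.comp_aemeasurable hX)
  have := Measure.isProbabilityMeasure_map hW
  have h1 : HasCondDistrib Y X κ P :=
    HasCondDistrib.comp_right (f := (Prod.fst : V × R → V)) (hf := measurable_fst) h
  have h2 := hasCondDistrib_shiftKernel hψ hX ⟨hW, rfl⟩ hind
  -- Both kernels are conditional laws of `Y` given `X`, hence they agree almost everywhere; so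
  -- conditioning on `Z` as well still gives a shift kernel.
  have hae : κ =ᵐ[P.map X] shiftKernel (P.map fun ω ↦ Y ω - ψ (X ω)) ψ hψ :=
    (condDistrib_ae_eq_of_measure_eq_compProd X hY h1.map_eq).symm.trans
      (condDistrib_ae_eq_of_measure_eq_compProd X hY h2.map_eq)
  have hae' : Kernel.prodMkRight R κ =ᵐ[P.map fun ω ↦ (X ω, Z ω)]
      shiftKernel (P.map fun ω ↦ Y ω - ψ (X ω)) (fun p : V × R ↦ ψ p.1)
        (hψ.comp measurable_fst) := by
    have h3 : ∀ᵐ p ∂(P.map fun ω ↦ (X ω, Z ω)),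
        κ p.1 = shiftKernel (P.map fun ω ↦ Y ω - ψ (X ω)) ψ hψ p.1 := by
      refine ae_of_ae_map (f := (Prod.fst : V × R → V)) measurable_fst.aemeasurable
        (p := fun v ↦ κ v = shiftKernel (P.map fun ω ↦ Y ω - ψ (X ω)) ψ hψ v) ?_
      rw [AEMeasurable.map_map_of_aemeasurable (by fun_prop) hXZ]
      exact hae
    filter_upwards [h3] with p hp
    rw [Kernel.prodMkRight_apply, hp, shiftKernel_apply, shiftKernel_apply]
  rw [HasCondDistrib, Measure.compProd_congr hae'] at h
  exact (HasCondDistrib.indepFun_sub _ h).2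

end ShiftKernel

/-- Supplies the weak continuity that singles out the bridge kernel among its almost-everywhere
versions. -/
lemma continuous_integral_shiftKernel {ι : Type*} [Fintype ι] (ν : Measure (ι → ℝ))
    [IsProbabilityMeasure ν] {ψ : ℝ → ι → ℝ} (hψ : Continuous ψ) (f : (ι → ℝ) →ᵇ ℝ) :
    Continuous fun y ↦ ∫ z, f z ∂(shiftKernel ν ψ hψ.measurable y) := by
  have h (y : ℝ) : ∫ z, f z ∂(shiftKernel ν ψ hψ.measurable y) = ∫ w, f (ψ y + w) ∂ν := by
    rw [shiftKernel_apply, integral_map (by fun_prop) (by fun_prop)]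
  simp_rw [h]
  refine continuous_of_dominated (fun y ↦ ?_) (fun y ↦ .of_forall fun w ↦ f.norm_coe_le_norm _)
    (integrable_const ‖f‖) (.of_forall fun w ↦ by fun_prop)
  exact (by fun_prop : Continuous fun w ↦ f (ψ y + w)).aestronglyMeasurable

/-! ### Primitives on `[0, 1)` and explicit formulas under the bridge condition. -/

section Calculus

variable {q F h σ : ℝ → ℝ} {S t : ℝ}

lemma intervalIntegrable_of_continuousOn_Ico (hq : ContinuousOn q (Set.Ico 0 1)) {s t : ℝ}
    (hs : s ∈ Set.Ico (0 : ℝ) 1) (ht : t ∈ Set.Ico (0 : ℝ) 1) :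
    IntervalIntegrable q volume s t :=
  (hq.mono fun _ hx ↦ ⟨(le_min hs.1 ht.1).trans hx.1, hx.2.trans_lt (max_lt hs.2 ht.2)⟩
    ).intervalIntegrable

lemma hasDerivAt_primitive (hq : ContinuousOn q (Set.Ico 0 1)) (ht : t ∈ Set.Ioo (0 : ℝ) 1) :
    HasDerivAt (fun t ↦ ∫ r in (0 : ℝ)..t, q r) (q t) t := by
  have hn : Set.Ioo (0 : ℝ) 1 ∈ 𝓝 t := Ioo_mem_nhds ht.1 ht.2
  have hq' : ContinuousOn q (Set.Ioo 0 1) := hq.mono Set.Ioo_subset_Ico_self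
  refine intervalIntegral.integral_hasDerivAt_right
    (intervalIntegrable_of_continuousOn_Ico hq (by simp) (Set.Ioo_subset_Ico_self ht)) ?_
    (hq'.continuousAt hn)
  exact hq'.stronglyMeasurableAtFilter isOpen_Ioo t ht

lemma continuousOn_primitive_Ico (hq : ContinuousOn q (Set.Ico 0 1)) :
    ContinuousOn (fun t ↦ ∫ r in (0 : ℝ)..t, q r) (Set.Ico 0 1) := by
  intro t ht
  obtain ⟨b, htb, hb1⟩ := exists_between ht.2
  have hb : b ∈ Set.Ico (0 : ℝ) 1 := ⟨ht.1.trans htb.le, hb1⟩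
  have h1 := intervalIntegral.continuousOn_primitive_interval'
    (intervalIntegrable_of_continuousOn_Ico hq (Set.left_mem_Ico.2 one_pos) hb)
    (Set.left_mem_uIcc)
  rw [Set.uIcc_of_le hb.1] at h1
  refine (h1 t ⟨ht.1, htb.le⟩).mono_of_mem_nhdsWithin ?_
  rw [mem_nhdsWithin]
  exact ⟨Set.Iio b, isOpen_Iio, htb, fun x hx ↦ ⟨hx.2.1, hx.1.le⟩⟩

lemma integral_eq_sub_of_hasDerivAt_Ioo (hq : ContinuousOn q (Set.Ico 0 1))
    (hF : ContinuousOn F (Set.Ico 0 1)) (hd : ∀ x ∈ Set.Ioo (0 : ℝ) 1, HasDerivAt F (q x) x)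
    {s t : ℝ} (hs : 0 ≤ s) (hst : s ≤ t) (ht : t < 1) :
    ∫ r in s..t, q r = F t - F s :=
  intervalIntegral.integral_eq_sub_of_hasDerivAt_of_le hst
    (hF.mono fun _ hx ↦ ⟨hs.trans hx.1, hx.2.trans_lt ht⟩)
    (fun x hx ↦ hd x ⟨hs.trans_lt hx.1, hx.2.trans ht⟩)
    (intervalIntegrable_of_continuousOn_Ico hq ⟨hs, hst.trans_lt ht⟩ ⟨hs.trans hst, ht⟩)

lemma phi_pos (h : ℝ → ℝ) (t : ℝ) : 0 < phi h t := Real.exp_pos _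

lemma phi_zero (h : ℝ → ℝ) : phi h 0 = 1 := by simp [phi]

lemma continuousOn_phi (hh : ContinuousOn h (Set.Ico 0 1)) :
    ContinuousOn (phi h) (Set.Ico 0 1) :=
  (continuousOn_primitive_Ico hh).neg.rexp

lemma hasDerivAt_phi (hh : ContinuousOn h (Set.Ico 0 1)) (ht : t ∈ Set.Ioo (0 : ℝ) 1) :
    HasDerivAt (phi h) (-(h t * phi h t)) t := by
  refine (hasDerivAt_primitive hh ht).neg.exp.congr_deriv ?_
  simp only [phi, Pi.neg_apply]
  ring

lemma continuousOn_div_phi (hh : ContinuousOn h (Set.Ico 0 1)) (hσ : ContinuousOn σ (Set.Ico 0 1)) :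
    ContinuousOn (fun r ↦ σ r / phi h r) (Set.Ico 0 1) :=
  hσ.div (continuousOn_phi hh) fun _ _ ↦ (phi_pos h _).ne'

lemma integral_sq_pos (hσ : ContinuousOn σ (Set.Ico 0 1))
    (hpos : ∀ t ∈ Set.Ico (0 : ℝ) 1, 0 < σ t) {s t : ℝ} (hs : 0 ≤ s) (hst : s < t) (ht : t < 1) :
    0 < ∫ r in s..t, σ r ^ 2 :=
  intervalIntegral.intervalIntegral_pos_of_pos_on
    (intervalIntegrable_of_continuousOn_Ico (hσ.pow 2) ⟨hs, hst.trans ht⟩ ⟨hs.trans hst.le, ht⟩)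
    (fun x hx ↦ pow_pos (hpos x ⟨hs.trans hx.1.le, hx.2.trans ht⟩) 2) hst

lemma integral_sq_add (hσ : ContinuousOn σ (Set.Ico 0 1)) {s t : ℝ} (hs : s ∈ Set.Ico (0 : ℝ) 1)
    (ht : t ∈ Set.Ico (0 : ℝ) 1) :
    (∫ r in (0 : ℝ)..s, σ r ^ 2) + ∫ r in s..t, σ r ^ 2 = ∫ r in (0 : ℝ)..t, σ r ^ 2 :=
  intervalIntegral.integral_add_adjacent_intervals
    (intervalIntegrable_of_continuousOn_Ico (hσ.pow 2) (by simp) hs)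
    (intervalIntegrable_of_continuousOn_Ico (hσ.pow 2) hs ht)

lemma integral_sq_lt_of_tendsto (hσ : ContinuousOn σ (Set.Ico 0 1))
    (hpos : ∀ t ∈ Set.Ico (0 : ℝ) 1, 0 < σ t)
    (hS : Tendsto (fun t : ℝ ↦ ∫ r in (0 : ℝ)..t, σ r ^ 2) (𝓝[<] 1) (𝓝 S))
    (ht : t ∈ Set.Ico (0 : ℝ) 1) : ∫ r in (0 : ℝ)..t, σ r ^ 2 < S := by
  -- An intermediate point makes the inequality strict in the limit.
  obtain ⟨b, htb, hb1⟩ := exists_between ht.2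
  have hb : b ∈ Set.Ico (0 : ℝ) 1 := ⟨ht.1.trans htb.le, hb1⟩
  have h1 : ∫ r in (0 : ℝ)..t, σ r ^ 2 < ∫ r in (0 : ℝ)..b, σ r ^ 2 := by
    rw [← integral_sq_add hσ ht hb]
    linarith [integral_sq_pos hσ hpos ht.1 htb hb1]
  refine h1.trans_le (ge_of_tendsto hS ?_)
  filter_upwards [Ioo_mem_nhdsLT hb1] with x hx
  rw [← integral_sq_add hσ hb ⟨hb.1.trans hx.1.le, hx.2⟩]
  linarith [integral_sq_pos hσ hpos hb.1 hx.1 hx.2]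

lemma integrableOn_sq_of_tendsto (hσ : ContinuousOn σ (Set.Ico 0 1))
    (hpos : ∀ t ∈ Set.Ico (0 : ℝ) 1, 0 < σ t)
    (hS : Tendsto (fun t : ℝ ↦ ∫ r in (0 : ℝ)..t, σ r ^ 2) (𝓝[<] 1) (𝓝 S)) :
    IntervalIntegrable (fun r ↦ σ r ^ 2) volume 0 1 := by
  rw [intervalIntegrable_iff_integrableOn_Ioc_of_le zero_le_one]
  have hb : Tendsto (fun n : ℕ ↦ (1 : ℝ) - 1 / ((n : ℝ) + 1)) atTop (𝓝 1) := by
    simpa using (tendsto_const_nhds (x := (1 : ℝ))).sub tendsto_one_div_add_atTop_nhds_zero_nat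
  have hmem (n : ℕ) : (1 : ℝ) - 1 / ((n : ℝ) + 1) ∈ Set.Ico (0 : ℝ) 1 := by
    have h1 : (0 : ℝ) < 1 / ((n : ℝ) + 1) := by positivity
    have h2 : 1 / ((n : ℝ) + 1) ≤ 1 := by
      rw [div_le_one (by positivity)]
      linarith [n.cast_nonneg (α := ℝ)]
    constructor <;> linarith
  refine integrableOn_Ioc_of_intervalIntegral_norm_bounded_right (I := S) (fun n ↦ ?_) hb
    (.of_forall fun n ↦ ?_)
  · exact (intervalIntegrable_iff_integrableOn_Ioc_of_le (hmem n).1).1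
      (intervalIntegrable_of_continuousOn_Ico (hσ.pow 2) (by simp) (hmem n))
  · simp only [norm_pow, Real.norm_eq_abs, sq_abs]
    rw [← intervalIntegral.integral_of_le (hmem n).1]
    exact (integral_sq_lt_of_tendsto hσ hpos hS (hmem n)).le

lemma integral_sq_zero_one (hσ : ContinuousOn σ (Set.Ico 0 1))
    (hpos : ∀ t ∈ Set.Ico (0 : ℝ) 1, 0 < σ t)
    (hS : Tendsto (fun t : ℝ ↦ ∫ r in (0 : ℝ)..t, σ r ^ 2) (𝓝[<] 1) (𝓝 S)) :
    ∫ r in (0 : ℝ)..1, σ r ^ 2 = S := by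
  have h1 := intervalIntegral.continuousOn_primitive_interval'
    (integrableOn_sq_of_tendsto hσ hpos hS) Set.left_mem_uIcc
  rw [Set.uIcc_of_le zero_le_one] at h1
  have h2 := (h1 1 ⟨zero_le_one, le_rfl⟩).tendsto
  refine tendsto_nhds_unique (f := fun t : ℝ ↦ ∫ r in (0 : ℝ)..t, σ r ^ 2) (l := 𝓝[<] 1) ?_ hS
  refine h2.mono_left ?_
  rw [← nhdsWithin_Ioo_eq_nhdsLT zero_lt_one]
  exact nhdsWithin_mono _ Set.Ioo_subset_Icc_self

/-- Under the bridge condition `-log (S - ∫₀ᵗ σ²)` is a primitive of `h`. -/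
lemma phi_eq_of_bridge (hh : ContinuousOn h (Set.Ico 0 1)) (hσ : ContinuousOn σ (Set.Ico 0 1))
    (hpos : ∀ t ∈ Set.Ico (0 : ℝ) 1, 0 < σ t)
    (hS : Tendsto (fun t : ℝ ↦ ∫ r in (0 : ℝ)..t, σ r ^ 2) (𝓝[<] 1) (𝓝 S))
    (hhS : ∀ t ∈ Set.Ico (0 : ℝ) 1, h t = σ t ^ 2 / (S - ∫ r in (0 : ℝ)..t, σ r ^ 2))
    (ht : t ∈ Set.Ico (0 : ℝ) 1) :
    phi h t = 1 - (∫ r in (0 : ℝ)..t, σ r ^ 2) / S := by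
  have hlt := fun t ht ↦ integral_sq_lt_of_tendsto hσ hpos hS (t := t) ht
  have hS0 : 0 < S := by simpa using hlt 0 (by simp)
  have hac := continuousOn_primitive_Ico (hσ.pow 2)
  have key : ∫ r in (0 : ℝ)..t, h r =
      -Real.log (S - ∫ r in (0 : ℝ)..t, σ r ^ 2) -
        -Real.log (S - ∫ r in (0 : ℝ)..0, σ r ^ 2) := by
    refine integral_eq_sub_of_hasDerivAt_Ioo
      (F := fun t ↦ -Real.log (S - ∫ r in (0 : ℝ)..t, σ r ^ 2)) hh ?_ (fun x hx ↦ ?_) le_rfl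
      ht.1 ht.2
    · exact ((continuousOn_const.sub hac).log fun x hx ↦ (sub_pos.2 (hlt x hx)).ne').neg
    · have hx' := Set.Ioo_subset_Ico_self hx
      refine (((hasDerivAt_primitive (hσ.pow 2) hx).const_sub S).log
        (sub_pos.2 (hlt x hx')).ne').neg.congr_deriv ?_
      rw [hhS x hx']
      simp only [Pi.pow_apply]
      ring
  rw [phi, key, intervalIntegral.integral_same, sub_zero, neg_sub, sub_neg_eq_add,
    add_comm, ← sub_eq_add_neg, Real.exp_sub,
    Real.exp_log hS0, Real.exp_log (sub_pos.2 (hlt t ht))]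
  field_simp

lemma h_mul_phi_of_bridge (hh : ContinuousOn h (Set.Ico 0 1)) (hσ : ContinuousOn σ (Set.Ico 0 1))
    (hpos : ∀ t ∈ Set.Ico (0 : ℝ) 1, 0 < σ t)
    (hS : Tendsto (fun t : ℝ ↦ ∫ r in (0 : ℝ)..t, σ r ^ 2) (𝓝[<] 1) (𝓝 S))
    (hhS : ∀ t ∈ Set.Ico (0 : ℝ) 1, h t = σ t ^ 2 / (S - ∫ r in (0 : ℝ)..t, σ r ^ 2))
    (ht : t ∈ Set.Ico (0 : ℝ) 1) :
    h t * phi h t = σ t ^ 2 / S := by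
  have hlt := fun t ht ↦ integral_sq_lt_of_tendsto hσ hpos hS (t := t) ht
  have hS0 : 0 < S := by simpa using hlt 0 (by simp)
  rw [phi_eq_of_bridge hh hσ hpos hS hhS ht, hhS t ht]
  have := (sub_pos.2 (hlt t ht)).ne'
  field_simp

/-- `S / φ` is a primitive of `σ² / φ²`, because `(1/φ)' = h φ / φ²` and `h φ = σ² / S`. -/
lemma integral_div_phi_sq_of_bridge (hh : ContinuousOn h (Set.Ico 0 1))
    (hσ : ContinuousOn σ (Set.Ico 0 1)) (hpos : ∀ t ∈ Set.Ico (0 : ℝ) 1, 0 < σ t)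
    (hS : Tendsto (fun t : ℝ ↦ ∫ r in (0 : ℝ)..t, σ r ^ 2) (𝓝[<] 1) (𝓝 S))
    (hhS : ∀ t ∈ Set.Ico (0 : ℝ) 1, h t = σ t ^ 2 / (S - ∫ r in (0 : ℝ)..t, σ r ^ 2))
    (ht : t ∈ Set.Ico (0 : ℝ) 1) :
    ∫ r in (0 : ℝ)..t, (σ r / phi h r) ^ 2 = S * (1 / phi h t - 1) := by
  have hlt := fun t ht ↦ integral_sq_lt_of_tendsto hσ hpos hS (t := t) ht
  have hS0 : 0 < S := by simpa using hlt 0 (by simp)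
  rw [integral_eq_sub_of_hasDerivAt_Ioo (q := fun r ↦ (σ r / phi h r) ^ 2) (F := fun t ↦ S * (phi h t)⁻¹)
    ((continuousOn_div_phi hh hσ).pow 2) ?_ (fun x hx ↦ ?_) le_rfl ht.1 ht.2, phi_zero]
  · ring
  · exact continuousOn_const.mul ((continuousOn_phi hh).inv₀ fun x _ ↦ (phi_pos h x).ne')
  · refine (((hasDerivAt_phi hh hx).inv (phi_pos h x).ne').const_mul S).congr_deriv ?_
    rw [neg_neg, h_mul_phi_of_bridge hh hσ hpos hS hhS (Set.Ioo_subset_Ico_self hx)]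
    field_simp

end Calculus

lemma tendsto_natCast_div_add_one_nnreal :
    Tendsto (fun n : ℕ ↦ (n : ℝ≥0) / (n + 1)) atTop (𝓝[<] 1) := by
  refine tendsto_nhdsWithin_iff.2 ⟨?_, .of_forall fun n ↦ ?_⟩
  · rw [← NNReal.tendsto_coe]
    have := tendsto_natCast_div_add_atTop (1 : ℝ)
    simpa using this
  · rw [Set.mem_Iio, div_lt_one (by positivity)]
    exact lt_add_one _

lemma tendsto_coe_nhdsLT_one :
    Tendsto (fun t : ℝ≥0 ↦ (t : ℝ)) (𝓝[<] 1) (𝓝[<] 1) := by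
  refine tendsto_nhdsWithin_iff.2 ⟨?_, ?_⟩
  · exact (NNReal.tendsto_coe.2 tendsto_id).mono_left nhdsWithin_le_nhds
  · filter_upwards [self_mem_nhdsWithin] with t ht
    exact_mod_cast ht

lemma eLpNorm_two_eq_ofReal_sqrt {α : Type*} [MeasurableSpace α] {μ : Measure α} {g : α → ℝ}
    (hg : MemLp g 2 μ) : eLpNorm g 2 μ = ENNReal.ofReal (√(∫ x, g x ^ 2 ∂μ)) := by
  rw [integral_sq_eq_norm_sq_toLp hg, Real.sqrt_sq (norm_nonneg _), Lp.norm_toLp,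
    ENNReal.ofReal_toReal hg.2.ne]

/-! ### The process `x + ∫ σ dB` on `[0, 1]` is Gaussian Markov. -/

section Sufficiency

variable {Ω : Type*} [MeasurableSpace Ω] {P : Measure Ω} {B M N : ℝ≥0 → Ω → ℝ}
  {hB : IsPreBrownianReal B P} {h σ : ℝ → ℝ} {S : ℝ}

lemma memLp_indicator_zero_one (hσ : ContinuousOn σ (Set.Ico 0 1))
    (hpos : ∀ t ∈ Set.Ico (0 : ℝ) 1, 0 < σ t)
    (hS : Tendsto (fun t : ℝ ↦ ∫ r in (0 : ℝ)..t, σ r ^ 2) (𝓝[<] 1) (𝓝 S)) :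
    MemLp ((Set.Ico (0 : ℝ) 1).indicator σ) 2 volume := by
  rw [memLp_indicator_iff_restrict measurableSet_Ico,
    memLp_two_iff_integrable_sq (hσ.aestronglyMeasurable measurableSet_Ico)]
  have := (intervalIntegrable_iff_integrableOn_Ioc_of_le zero_le_one).1
    (integrableOn_sq_of_tendsto hσ hpos hS)
  exact (integrableOn_Ico_iff_integrableOn_Ioo (μ := volume)).2
    ((integrableOn_Ioc_iff_integrableOn_Ioo (μ := volume)).1 this)

lemma tendsto_eLpNorm_indicator_sub (hσ : ContinuousOn σ (Set.Ico 0 1))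
    (hpos : ∀ t ∈ Set.Ico (0 : ℝ) 1, 0 < σ t)
    (hS : Tendsto (fun t : ℝ ↦ ∫ r in (0 : ℝ)..t, σ r ^ 2) (𝓝[<] 1) (𝓝 S))
    {τ : ℕ → ℝ≥0} (hτ : Tendsto τ atTop (𝓝[<] 1)) :
    Tendsto (fun n ↦ eLpNorm ((Set.Ico (0 : ℝ) (τ n)).indicator σ -
      (Set.Ico (0 : ℝ) 1).indicator σ) 2 volume) atTop (𝓝 0) := by
  have hm1 := memLp_indicator_zero_one hσ hpos hS
  have hint : Integrable (fun x ↦ (Set.Ico (0 : ℝ) 1).indicator σ x ^ 2) := hm1.integrable_sq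
  have hone : ∫ x, (Set.Ico (0 : ℝ) 1).indicator σ x ^ 2 = S := by
    rw [← integral_sq_zero_one hσ hpos hS]
    have := integral_indicator_Ico_mul_indicator σ (le_refl (1 : ℝ≥0))
    simp only [NNReal.coe_one] at this
    simpa only [sq] using this
  have hev : ∀ᶠ n in atTop, eLpNorm ((Set.Ico (0 : ℝ) (τ n)).indicator σ -
      (Set.Ico (0 : ℝ) 1).indicator σ) 2 volume =
        ENNReal.ofReal (√(S - ∫ r in (0 : ℝ)..τ n, σ r ^ 2)) := by
    filter_upwards [hτ.eventually self_mem_nhdsWithin] with n hn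
    have hmn := memLp_indicator_of_continuousOn (continuousOn_Icc_of_lt hσ hn)
    have hint' : Integrable (fun x ↦ (Set.Ico (0 : ℝ) (τ n)).indicator σ x *
      (Set.Ico (0 : ℝ) (τ n)).indicator σ x) := hmn.integrable_mul hmn
    rw [eLpNorm_two_eq_ofReal_sqrt (hmn.sub hm1), ← hone,
      ← integral_indicator_Ico_mul_indicator σ (le_refl (τ n)),
      ← integral_sub hint hint']
    congr 3 with x
    have hn' : (τ n : ℝ) < 1 := by exact_mod_cast hn
    simp only [Pi.sub_apply, Set.indicator_apply, Set.mem_Ico]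
    split_ifs <;> grind
  have hlim : Tendsto (fun n ↦ ENNReal.ofReal (√(S - ∫ r in (0 : ℝ)..τ n, σ r ^ 2))) atTop
      (𝓝 (ENNReal.ofReal (√(S - S)))) :=
    (ENNReal.continuous_ofReal.tendsto _).comp ((Real.continuous_sqrt.tendsto _).comp
      (tendsto_const_nhds.sub ((hS.comp tendsto_coe_nhdsLT_one).comp hτ)))
  rw [sub_self, Real.sqrt_zero, ENNReal.ofReal_zero] at hlim
  exact hlim.congr' (hev.mono fun n hn ↦ hn.symm)

/-- `IsWienerIntegral` says nothing at time 1; there `N 1` is identified as the pathwise limit of `N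
(n / (n + 1))`. -/
lemma hasRep_of_le_one (hσ : ContinuousOn σ (Set.Ico 0 1))
    (hpos : ∀ t ∈ Set.Ico (0 : ℝ) 1, 0 < σ t)
    (hS : Tendsto (fun t : ℝ ↦ ∫ r in (0 : ℝ)..t, σ r ^ 2) (𝓝[<] 1) (𝓝 S))
    (hN : IsWienerIntegral σ B N P) (hNc : ∀ᵐ ω ∂P, ContinuousOn (fun t ↦ N t ω) (Set.Iic 1))
    {t : ℝ≥0} (ht : t ≤ 1) : HasRep hB (N t) ((Set.Ico (0 : ℝ) t).indicator σ) := by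
  rcases ht.lt_or_eq with ht | rfl
  · exact hN.hasRep hB hσ ht
  rw [NNReal.coe_one]
  refine HasRep.of_tendsto_ae (fun n ↦ hN.hasRep hB hσ
    (show (n : ℝ≥0) / (n + 1) < 1 by
      rw [div_lt_one (by positivity)]
      exact lt_add_one _)) (memLp_indicator_zero_one hσ hpos hS) ?_
    (tendsto_eLpNorm_indicator_sub hσ hpos hS tendsto_natCast_div_add_one_nnreal)
  filter_upwards [hNc] with ω hω
  refine ((hω 1 (Set.self_mem_Iic)).mono Set.Iio_subset_Iic_self).tendsto.comp
    tendsto_natCast_div_add_one_nnreal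

lemma covariance_of_hasRep (hN : ∀ t : ℝ≥0, t ≤ 1 → HasRep hB (N t) ((Set.Ico (0 : ℝ) t).indicator σ))
    {s t : ℝ≥0} (hst : s ≤ t) (ht : t ≤ 1) :
    cov[N s, N t; P] = ∫ r in (0 : ℝ)..s, σ r ^ 2 := by
  rw [(hN s (hst.trans ht)).covariance_eq (hN t ht), integral_indicator_Ico_mul_indicator σ hst]

lemma indepFun_increment {s t : ℝ≥0}
    (hN : ∀ t : ℝ≥0, t ≤ 1 → HasRep hB (N t) ((Set.Ico (0 : ℝ) t).indicator σ))
    (hst : s ≤ t) (ht : t ≤ 1) (J : Finset ℝ≥0) (hJ : ∀ r ∈ J, r ≤ s) :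
    IndepFun (fun ω ↦ (N s ω, fun r : J ↦ N r ω)) (fun ω ↦ N t ω - N s ω) P := by
  have := hB.isGaussianProcess.isProbabilityMeasure
  have hle (o : Option J) : (o.elim s fun r ↦ (r : ℝ≥0)) ≤ s := by
    cases o with
    | none => exact le_rfl
    | some r => exact hJ r r.2
  -- `none` stands for the present time `s`, `some r` for past times, and `Unit` for the increment;
  -- joint Gaussianity reduces independence to vanishing covariances.
  let Y : Option J ⊕ Unit → Ω → ℝ := Sum.elim (fun o ω ↦ N (o.elim s fun r ↦ r) ω)
    (fun _ ω ↦ N t ω - N s ω)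
  let k : Option J ⊕ Unit → ℝ → ℝ := Sum.elim
    (fun o ↦ (Set.Ico (0 : ℝ) ((o.elim s fun r ↦ r : ℝ≥0) : ℝ)).indicator σ)
    (fun _ ↦ (Set.Ico (0 : ℝ) t).indicator σ - (Set.Ico (0 : ℝ) s).indicator σ)
  have hY : ∀ i, HasRep hB (Y i) (k i) := by
    rintro (o | _)
    · exact hN _ ((hle o).trans (hst.trans ht))
    · exact (hN t ht).sub (hN s (hst.trans ht))
  have hG := (hasGaussianLaw_of_hasRep hY).map
    ((ContinuousLinearMap.pi fun o : Option J ↦ ContinuousLinearMap.proj (Sum.inl o)).prod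
      (ContinuousLinearMap.pi fun o : Unit ↦ ContinuousLinearMap.proj (Sum.inr o)) :
      (Option J ⊕ Unit → ℝ) →L[ℝ] (Option J → ℝ) × (Unit → ℝ))
  have hind := HasGaussianLaw.indepFun_of_covariance_eval (X := fun o : Option J ↦ Y (.inl o))
    (Y := fun o : Unit ↦ Y (.inr o)) hG fun o _ ↦ by
      change cov[N _, N t - N s; P] = 0
      rw [covariance_sub_right (hN _ ((hle o).trans (hst.trans ht))).memLp (hN t ht).memLp
        (hN s (hst.trans ht)).memLp, covariance_of_hasRep hN ((hle o).trans hst) ht,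
        covariance_of_hasRep hN (hle o) (hst.trans ht), sub_self]
  exact hind.comp (φ := fun z : Option J → ℝ ↦ (z none, fun r : J ↦ z (some r)))
    (ψ := fun z : Unit → ℝ ↦ z ()) (by fun_prop) (by fun_prop)

lemma hasLaw_increment {s t : ℝ≥0}
    (hN : ∀ t : ℝ≥0, t ≤ 1 → HasRep hB (N t) ((Set.Ico (0 : ℝ) t).indicator σ))
    (hst : s ≤ t) (ht : t ≤ 1) :
    HasLaw (fun ω ↦ N t ω - N s ω)
      (gaussianReal 0 (∫ x, ((Set.Ico (0 : ℝ) t).indicator σ x -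
        (Set.Ico (0 : ℝ) s).indicator σ x) ^ 2).toNNReal) P :=
  ((hN t ht).sub (hN s (hst.trans ht))).hasLaw

lemma isGaussianMarkov_of_hasRep
    (hN : ∀ t : ℝ≥0, t ≤ 1 → HasRep hB (N t) ((Set.Ico (0 : ℝ) t).indicator σ))
    (hpos : ∀ t : ℝ≥0, 0 < t → t ≤ 1 → 0 < ∫ r in (0 : ℝ)..t, σ r ^ 2)
    (hNc : ∀ᵐ ω ∂P, ContinuousOn (fun t ↦ N t ω) (Set.Iic 1)) :
    IsGaussianMarkov (fun x t ω ↦ x + N t ω) P := by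
  have := hB.isGaussianProcess.isProbabilityMeasure
  refine ⟨fun x ↦ ⟨fun I ↦ ?_⟩, fun x ↦ ?_, fun x ↦ ?_, fun x t h0 h1 ↦ ?_, ?_⟩
  · have hG := hasGaussianLaw_of_hasRep (Y := fun t : I ↦ N t.1.1) fun t ↦ hN t.1.1 t.1.2
    have := hG.isGaussian_map
    refine ⟨?_⟩
    have h1 : IsGaussian ((P.map fun ω (t : I) ↦ N t.1.1 ω).map fun z ↦ (fun _ ↦ x) + z) :=
      inferInstance
    rwa [AEMeasurable.map_map_of_aemeasurable (by fun_prop) hG.aemeasurable] at h1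
  · filter_upwards [hNc] with ω hω
    exact continuousOn_const.add hω
  · have h0 := (hN 0 zero_le_one).ae_eq ((hasRep_zero (hB := hB)).congr .rfl
      (g' := (Set.Ico (0 : ℝ) ((0 : ℝ≥0) : ℝ)).indicator σ) (by simp; rfl))
    filter_upwards [h0] with ω hω
    simp [hω]
  · rw [variance_const_add (hN t h1).memLp.1, (hN t h1).variance_eq]
    have := integral_indicator_Ico_mul_indicator σ (le_refl t)
    simp only [← sq] at this
    rw [this]
    exact hpos t h0 h1
  · refine ⟨fun s t ↦ shiftKernel (gaussianReal 0 (∫ x, ((Set.Ico (0 : ℝ) t).indicator σ x -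
        (Set.Ico (0 : ℝ) s).indicator σ x) ^ 2).toNNReal) id measurable_id,
      fun s t hst ht ↦ ⟨inferInstance, fun x J hJ ↦ ?_⟩⟩
    have hk : Kernel.prodMkRight (J → ℝ) (shiftKernel (gaussianReal 0
        (∫ x, ((Set.Ico (0 : ℝ) t).indicator σ x -
          (Set.Ico (0 : ℝ) s).indicator σ x) ^ 2).toNNReal) id measurable_id) =
        shiftKernel (gaussianReal 0 (∫ x, ((Set.Ico (0 : ℝ) t).indicator σ x -
          (Set.Ico (0 : ℝ) s).indicator σ x) ^ 2).toNNReal)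
          (fun p : ℝ × (J → ℝ) ↦ p.1) measurable_fst := by
      ext1 p
      rw [Kernel.prodMkRight_apply, shiftKernel_apply, shiftKernel_apply]
      rfl
    have hW (ω : Ω) : x + N t ω - (x + N s ω) = N t ω - N s ω := by ring
    rw [hk]
    refine hasCondDistrib_shiftKernel _ ?_ ?_ ?_
    · refine AEMeasurable.prodMk (((hN s (hst.trans ht)).memLp.aemeasurable).const_add x) ?_
      exact aemeasurable_pi_lambda _ fun r ↦
        ((hN r ((hJ r r.2).trans (hst.trans ht))).memLp.aemeasurable).const_add x
    · simpa only [hW] using hasLaw_increment hN hst ht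
    · simp only [hW]
      exact (indepFun_increment hN hst ht J hJ).comp
        (φ := fun p : ℝ × (J → ℝ) ↦ (x + p.1, fun r : J ↦ x + p.2 r)) (ψ := id)
        (by fun_prop) measurable_id

end Sufficiency

/-! ### Identification of the bridges of `x + ∫ σ dB`. -/

section Bridges

variable {Ω : Type*} [MeasurableSpace Ω] {P : Measure Ω} {B M N : ℝ≥0 → Ω → ℝ}
  {hB : IsPreBrownianReal B P} {h σ f : ℝ → ℝ} {S : ℝ}

lemma covariance_min_of_hasRep {s t : ℝ≥0} {Y Y' : Ω → ℝ}
    (hs : HasRep hB Y ((Set.Ico (0 : ℝ) s).indicator f))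
    (ht : HasRep hB Y' ((Set.Ico (0 : ℝ) t).indicator f)) :
    cov[Y, Y'; P] = ∫ r in (0 : ℝ)..(min s t : ℝ≥0), f r ^ 2 := by
  rcases le_total s t with hst | hst
  · rw [hs.covariance_eq ht, integral_indicator_Ico_mul_indicator f hst, min_eq_left hst]
  · rw [covariance_comm, ht.covariance_eq hs, integral_indicator_Ico_mul_indicator f hst,
      min_eq_right hst]

lemma map_const_add_eq {ι : Type*} [Fintype ι] {Y Y' : Ω → ι → ℝ} (hY : AEMeasurable Y P)
    (hY' : AEMeasurable Y' P) (hYY' : P.map Y = P.map Y') (c : ι → ℝ) :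
    P.map (fun ω ↦ c + Y ω) = P.map (fun ω ↦ c + Y' ω) := by
  have hc : Measurable fun z : ι → ℝ ↦ c + z := by fun_prop
  have := congrArg (fun μ ↦ μ.map fun z : ι → ℝ ↦ c + z) hYY'
  simp only [AEMeasurable.map_map_of_aemeasurable hc.aemeasurable hY,
    AEMeasurable.map_map_of_aemeasurable hc.aemeasurable hY'] at this
  exact this

lemma diffusion_eq_add {Ω : Type*} (h : ℝ → ℝ) (M : ℝ≥0 → Ω → ℝ) (x y : ℝ) (t : ℝ≥0) (ω : Ω) :
    diffusion h M x y t ω = (1 - phi h t) * y + diffusion h M x 0 t ω := by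
  simp only [diffusion]
  ring

/-- The covariances of the bridge of `∫ σ dB` and of `φ ∫ σ / φ dB` agree. -/
lemma covariance_bridge_eq
    (hN : ∀ t : ℝ≥0, t ≤ 1 → HasRep hB (N t) ((Set.Ico (0 : ℝ) t).indicator σ))
    (hM : ∀ t : ℝ≥0, t < 1 → HasRep hB (M t)
      ((Set.Ico (0 : ℝ) t).indicator fun r ↦ σ r / phi h r))
    (hS0 : S ≠ 0) (hS : ∫ r in (0 : ℝ)..1, σ r ^ 2 = S)
    (hphi : ∀ t : ℝ≥0, t < 1 → phi h t = 1 - (∫ r in (0 : ℝ)..t, σ r ^ 2) / S)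
    (hV : ∀ t : ℝ≥0, t < 1 → ∫ r in (0 : ℝ)..t, (σ r / phi h r) ^ 2 = S * (1 / phi h t - 1))
    {s t : ℝ≥0} (hs : s < 1) (ht : t < 1) :
    cov[N s - (1 - phi h s) • N 1, N t - (1 - phi h t) • N 1; P] =
      cov[phi h s • M s, phi h t • M t; P] := by
  have := hB.isGaussianProcess.isProbabilityMeasure
  have m1 := (hN 1 le_rfl).memLp
  have ms := (hN s hs.le).memLp
  have mt := (hN t ht.le).memLp
  have ha (r : ℝ≥0) (hr : r < 1) : ∫ x in (0 : ℝ)..r, σ x ^ 2 = S * (1 - phi h r) := by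
    rw [hphi r hr]
    field_simp
    ring
  have hmin : min s t < 1 := (min_le_left s t).trans_lt hs
  rw [covariance_sub_left ms (m1.const_smul _) (mt.sub (m1.const_smul _)),
    covariance_sub_right ms mt (m1.const_smul _),
    covariance_sub_right (m1.const_smul _) mt (m1.const_smul _),
    covariance_smul_left, covariance_smul_left, covariance_smul_right, covariance_smul_right,
    covariance_smul_left, covariance_smul_right,
    covariance_min_of_hasRep (hN s hs.le) (hN t ht.le),
    covariance_min_of_hasRep (hN s hs.le) (hN 1 le_rfl),
    covariance_min_of_hasRep (hN 1 le_rfl) (hN t ht.le),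
    covariance_min_of_hasRep (hN 1 le_rfl) (hN 1 le_rfl),
    covariance_min_of_hasRep (hM s hs) (hM t ht), min_self, min_eq_left hs.le,
    min_eq_right ht.le, NNReal.coe_one, hS, ha _ hmin, hV _ hmin, ha s hs, ha t ht]
  have ps := (phi_pos h s).ne'
  have pt := (phi_pos h t).ne'
  rcases le_total s t with hst | hst
  · rw [min_eq_left hst]
    field_simp
    ring
  · rw [min_eq_right hst]
    field_simp
    ring

/-- The bridge kernel is the law of `X^{x0}` shifted by `(1 - φ) y`. It is the conditional law
because the residual of `x + N_t` after subtracting `(1 - φ(t)) (x + N_1)` has the law of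
`X^{x0}_t`, jointly in `t`, and is independent of `N_1`. -/
lemma areBridges_of_hasRep
    (hN : ∀ t : ℝ≥0, t ≤ 1 → HasRep hB (N t) ((Set.Ico (0 : ℝ) t).indicator σ))
    (hM : ∀ t : ℝ≥0, t < 1 → HasRep hB (M t)
      ((Set.Ico (0 : ℝ) t).indicator fun r ↦ σ r / phi h r))
    (hS0 : S ≠ 0) (hS : ∫ r in (0 : ℝ)..1, σ r ^ 2 = S)
    (hphi : ∀ t : ℝ≥0, t < 1 → phi h t = 1 - (∫ r in (0 : ℝ)..t, σ r ^ 2) / S)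
    (hV : ∀ t : ℝ≥0, t < 1 → ∫ r in (0 : ℝ)..t, (σ r / phi h r) ^ 2 = S * (1 / phi h t - 1)) :
    AreBridges (diffusion h M) P (fun x t ω ↦ x + N t ω) P := by
  have := hB.isGaussianProcess.isProbabilityMeasure
  intro x J hJ
  have hX (y : ℝ) : AEMeasurable (fun ω ↦ J.restrict fun t ↦ diffusion h M x y t ω) P :=
    aemeasurable_pi_lambda _ fun t ↦ by
      have := (hM t (hJ t t.2)).memLp.aemeasurable
      exact (this.const_mul _).const_add _
  have hprob := Measure.isProbabilityMeasure_map (hX 0)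
  have hψ : Continuous fun (y : ℝ) (t : J) ↦ (1 - phi h t) * y := by fun_prop
  have hY (t : J) : HasRep hB (N t - (1 - phi h t) • N 1) _ :=
    (hN t (hJ t t.2).le).sub ((hN 1 le_rfl).smul (1 - phi h t))
  have hY' (t : J) : HasRep hB (phi h t • M t) _ := (hM t (hJ t t.2)).smul (phi h t)
  have hlaw : HasLaw (fun ω ↦ (fun t : J ↦ x + N t ω) - fun t : J ↦ (1 - phi h t) * (x + N 1 ω))
      (P.map fun ω ↦ J.restrict fun t ↦ diffusion h M x 0 t ω) P := by
    refine ⟨?_, ?_⟩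
    · refine AEMeasurable.sub (aemeasurable_pi_lambda _ fun t ↦ ?_)
        (aemeasurable_pi_lambda _ fun t ↦ ?_)
      · exact (hN t (hJ t t.2).le).memLp.aemeasurable.const_add x
      · exact ((hN 1 le_rfl).memLp.aemeasurable.const_add x).const_mul _
    · have hmap := map_eq_of_hasRep hY hY' fun s t ↦ by
        rw [← (hY s).covariance_eq (hY t), ← (hY' s).covariance_eq (hY' t)]
        exact covariance_bridge_eq hN hM hS0 hS hphi hV (hJ s s.2) (hJ t t.2)
      have hmap' := map_const_add_eq
        (aemeasurable_pi_lambda _ fun t ↦ (hY t).memLp.aemeasurable)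
        (aemeasurable_pi_lambda _ fun t ↦ (hY' t).memLp.aemeasurable) hmap
        (fun t : J ↦ phi h t * x)
      convert hmap' using 2
      · ext ω t
        simp only [Pi.sub_apply, Pi.add_apply, Pi.smul_apply, smul_eq_mul]
        ring
      · ext ω t
        simp [diffusion]
  refine ⟨shiftKernel (P.map fun ω ↦ J.restrict fun t ↦ diffusion h M x 0 t ω)
    (fun (y : ℝ) (t : J) ↦ (1 - phi h t) * y) hψ.measurable,
    ⟨inferInstance, ?_, continuous_integral_shiftKernel _ hψ⟩, fun y ↦ ⟨hX y, ?_⟩⟩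
  · refine hasCondDistrib_shiftKernel _ ((hN 1 le_rfl).memLp.aemeasurable.const_add x) hlaw ?_
    have hG := (hasGaussianLaw_of_hasRep (hB := hB)
      (Y := Sum.elim (fun _ : Unit ↦ N 1) fun t : J ↦ N t - (1 - phi h t) • N 1)
      (g := Sum.elim (fun _ ↦ _) fun t ↦ _)
      (by
        rintro (_ | t)
        · exact hN 1 le_rfl
        · exact hY t)).map
      ((ContinuousLinearMap.pi fun o : Unit ↦ ContinuousLinearMap.proj (Sum.inl o)).prod
        (ContinuousLinearMap.pi fun o : J ↦ ContinuousLinearMap.proj (Sum.inr o)) :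
        (Unit ⊕ J → ℝ) →L[ℝ] (Unit → ℝ) × (J → ℝ))
    -- The covariance vanishes since `cov(N_t, N_1) = ∫₀ᵗ σ² = (1 - φ(t)) S`.
    have hind := HasGaussianLaw.indepFun_of_covariance_eval (X := fun _ : Unit ↦ N 1)
      (Y := fun t : J ↦ N t - (1 - phi h t) • N 1) hG fun _ t ↦ by
        rw [covariance_sub_right (hN 1 le_rfl).memLp (hN t (hJ t t.2).le).memLp
          ((hN 1 le_rfl).memLp.const_smul _), covariance_smul_right,
          covariance_min_of_hasRep (hN 1 le_rfl) (hN t (hJ t t.2).le),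
          covariance_min_of_hasRep (hN 1 le_rfl) (hN 1 le_rfl), min_self,
          min_eq_right (hJ t t.2).le, NNReal.coe_one, hS, hphi t (hJ t t.2)]
        field_simp
        ring
    have hcomp := hind.comp (φ := fun z : Unit → ℝ ↦ x + z ())
      (ψ := fun (z : J → ℝ) (t : J) ↦ phi h t * x + z t) (by fun_prop) (by fun_prop)
    convert hcomp using 1
    · rfl
    refine funext fun ω ↦ funext fun t ↦ ?_
    simp only [Pi.sub_apply, Pi.smul_apply, smul_eq_mul, Function.comp_apply, Finset.restrict]
    ring
  · rw [shiftKernel_apply, AEMeasurable.map_map_of_aemeasurable (by fun_prop) (hX 0)]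
    congr 1 with ω t
    simp only [Finset.restrict, Function.comp_apply, Pi.add_apply]
    exact diffusion_eq_add h M x y t ω

end Bridges

/-! ### Pathwise Riemann–Stieltjes sums and summation by parts. -/

section RiemannStieltjes

variable {F w φ : ℝ → ℝ} {t : ℝ≥0}

lemma coe_mem_Ico {s t : ℝ≥0} (hs : s ≤ t) (ht : t < 1) : (s : ℝ) ∈ Set.Ico (0 : ℝ) 1 :=
  ⟨s.coe_nonneg, by exact_mod_cast hs.trans_lt ht⟩

/-- The cell weights are exact integrals of `w`, so for `w = h φ = -φ'` they become increments of
`φ`. -/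
lemma tendsto_sum_mul_integral (hF : ContinuousOn F (Set.Icc 0 (t : ℝ)))
    (hw : ContinuousOn w (Set.Ico 0 1)) (ht : t < 1) :
    Tendsto (fun n ↦ ∑ k ∈ Finset.range n,
        F (grid t n k) * ∫ r in (grid t n k : ℝ)..grid t n (k + 1), w r) atTop
      (𝓝 (∫ r in (0 : ℝ)..t, F r * w r)) := by
  rw [Metric.tendsto_atTop']
  intro ε hε
  set A := ∫ r in (0 : ℝ)..t, |w r|
  have hA : 0 ≤ A := intervalIntegral.integral_nonneg t.coe_nonneg fun _ _ ↦ abs_nonneg _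
  -- The `+ 1` covers `A = 0` and makes the final bound strict.
  have hδ : 0 < ε / (A + 1) := by positivity
  obtain ⟨n₀, hn₀⟩ := eventually_atTop.1
    ((eventually_abs_sub_le_of_cell hF hδ).and (eventually_ne_atTop 0))
  refine ⟨n₀, fun n hn ↦ ?_⟩
  obtain ⟨hcell, hn0⟩ := hn₀ n hn.le
  have hgm {k : ℕ} (hk : k ≤ n) : (grid t n k : ℝ) ∈ Set.Ico (0 : ℝ) 1 :=
    coe_mem_Ico (grid_le t hk) ht
  have hle (k : ℕ) : (grid t n k : ℝ) ≤ grid t n (k + 1) := by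
    exact_mod_cast grid_mono t n k.le_succ
  have hwi {k : ℕ} (hk : k < n) :
      IntervalIntegrable w volume (grid t n k) (grid t n (k + 1)) :=
    intervalIntegrable_of_continuousOn_Ico hw (hgm hk.le) (hgm hk)
  have hFw {k : ℕ} (hk : k < n) :
      IntervalIntegrable (fun r ↦ F r * w r) volume (grid t n k) (grid t n (k + 1)) := by
    refine ContinuousOn.intervalIntegrable_of_Icc (hle k) ?_
    refine (hF.mono fun x hx ↦ ⟨(hgm hk.le).1.trans hx.1, hx.2.trans ?_⟩).mul
      (hw.mono fun x hx ↦ ⟨(hgm hk.le).1.trans hx.1, hx.2.trans_lt (hgm hk).2⟩)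
    exact_mod_cast grid_le t hk
  have h0n (q : ℝ → ℝ) : ∫ r in (grid t n 0 : ℝ)..grid t n n, q r = ∫ r in (0 : ℝ)..t, q r := by
    rw [grid_zero, grid_self t hn0, NNReal.coe_zero]
  have hsumF := intervalIntegral.sum_integral_adjacent_intervals
    (a := fun k ↦ (grid t n k : ℝ)) fun k hk ↦ hFw hk
  have hsumw := intervalIntegral.sum_integral_adjacent_intervals
    (a := fun k ↦ (grid t n k : ℝ)) fun k hk ↦ (hwi hk).abs
  rw [h0n] at hsumF hsumw
  rw [Real.dist_eq, ← hsumF, ← Finset.sum_sub_distrib]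
  calc |∑ k ∈ Finset.range n, (F (grid t n k) * (∫ r in (grid t n k : ℝ)..grid t n (k + 1), w r) -
        ∫ r in (grid t n k : ℝ)..grid t n (k + 1), F r * w r)|
      ≤ ∑ k ∈ Finset.range n, ε / (A + 1) * ∫ r in (grid t n k : ℝ)..grid t n (k + 1), |w r| := by
        refine (Finset.abs_sum_le_sum_abs _ _).trans (Finset.sum_le_sum fun k hk ↦ ?_)
        have hk' := Finset.mem_range.1 hk
        rw [← intervalIntegral.integral_const_mul, ← intervalIntegral.integral_const_mul,
          ← intervalIntegral.integral_sub ((hwi hk').const_mul _) (hFw hk')]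
        refine intervalIntegral.norm_integral_le_of_norm_le (μ := volume)
          (f := fun r ↦ F (grid t n k) * w r - F r * w r) (g := fun r ↦ ε / (A + 1) * |w r|)
          (hle k) (.of_forall fun r hr ↦ ?_) ((hwi hk').abs.const_mul _)
        rw [← sub_mul, Real.norm_eq_abs, abs_mul]
        gcongr
        exact hcell k hk' _ (left_mem_cell t n k) r ⟨hr.1.le, hr.2⟩
    _ = ε / (A + 1) * A := by rw [← Finset.mul_sum, hsumw]
    _ < ε := by
        rw [div_mul_eq_mul_div, div_lt_iff₀ (by positivity)]
        nlinarith

lemma continuousOn_comp_toNNReal {m : ℝ≥0 → ℝ} (hm : ContinuousOn m (Set.Iio 1)) :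
    ContinuousOn (fun r : ℝ ↦ m r.toNNReal) (Set.Iio 1) :=
  hm.comp continuous_real_toNNReal.continuousOn fun _ hx ↦ Real.toNNReal_lt_one.2 hx

lemma tendsto_sum_right_increments {m : ℝ≥0 → ℝ} (hm : ContinuousOn m (Set.Iio 1)) (hm0 : m 0 = 0)
    (hw : ContinuousOn w (Set.Ico 0 1))
    (hφ : ∀ a b : ℝ, 0 ≤ a → a ≤ b → b < 1 → ∫ r in a..b, w r = φ a - φ b) (ht : t < 1) :
    Tendsto (fun n ↦ ∑ k ∈ Finset.range n,
        φ (grid t n (k + 1)) * (m (grid t n (k + 1)) - m (grid t n k))) atTop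
      (𝓝 (φ t * m t + ∫ r in (0 : ℝ)..t, m r.toNNReal * w r)) := by
  have h1 := (tendsto_sum_mul_integral (t := t) (F := fun r ↦ m r.toNNReal)
    ((continuousOn_comp_toNNReal hm).mono fun x hx ↦
      hx.2.trans_lt (by exact_mod_cast ht)) hw ht).const_add (φ t * m t)
  refine h1.congr' ?_
  filter_upwards [eventually_ne_atTop 0] with n hn
  have h2 : ∑ k ∈ Finset.range n,
      (φ (grid t n (k + 1)) * m (grid t n (k + 1)) - φ (grid t n k) * m (grid t n k)) =
      φ t * m t := by
    rw [Finset.sum_range_sub (fun k ↦ φ (grid t n k) * m (grid t n k)), grid_self t hn, grid_zero,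
      hm0]
    ring
  -- Termwise summation by parts: `φ_{k+1} (m_{k+1} - m_k) = (φ_{k+1} m_{k+1} - φ_k m_k) + m_k (φ_k
  -- - φ_{k+1})`. Right nodes for `φ` leave left nodes for `m`.
  rw [← h2, ← Finset.sum_add_distrib]
  refine Finset.sum_congr rfl fun k hk ↦ ?_
  have hk' := Finset.mem_range.1 hk
  rw [hφ _ _ (grid t n k).coe_nonneg (by exact_mod_cast grid_mono t n k.le_succ)
    (coe_mem_Ico (grid_le t hk') ht).2, Real.toNNReal_coe]
  ring

lemma continuousOn_ite_lt_one {g : ℝ≥0 → ℝ} (hg : ContinuousOn g (Set.Iio 1))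
    (hg1 : Tendsto g (𝓝[<] 1) (𝓝 0)) :
    ContinuousOn (fun t ↦ if t < 1 then g t else 0) (Set.Iic 1) := by
  intro t ht
  rcases (show t ≤ 1 from ht).lt_or_eq with ht | rfl
  · refine ContinuousAt.continuousWithinAt ?_
    refine (hg.continuousAt (Iio_mem_nhds ht)).congr ?_
    filter_upwards [Iio_mem_nhds ht] with s hs
    rw [if_pos (show s < 1 from hs)]
  · rw [← Set.Iio_insert, continuousWithinAt_insert_self, ContinuousWithinAt, if_neg (lt_irrefl _)]
    refine hg1.congr' ?_
    filter_upwards [self_mem_nhdsWithin] with s hs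
    rw [if_pos (show s < 1 from hs)]

/-- Discrete form of `∫ √(S/p) dp = 2 √S √p`; the right-hand side telescopes over a partition. -/
lemma sub_mul_sqrt_div_le {p q S : ℝ} (hS : 0 ≤ S) (hp : 0 < p) (hq : 0 ≤ q) (hqp : q ≤ p) :
    √(S / p) * (p - q) ≤ 2 * √S * (√p - √q) := by
  have h1 : √q ≤ √p := Real.sqrt_le_sqrt hqp
  have h2 : 0 < √p := Real.sqrt_pos.2 hp
  rw [Real.sqrt_div hS, div_mul_eq_mul_div, div_le_iff₀ h2]
  have h3 : p - q = (√p - √q) * (√p + √q) := by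
    nlinarith [Real.sq_sqrt hp.le, Real.sq_sqrt hq]
  rw [h3]
  have h4 : 0 ≤ √S * (√p - √q) := mul_nonneg (Real.sqrt_nonneg _) (sub_nonneg.2 h1)
  nlinarith [mul_le_mul_of_nonneg_left (by linarith : √p + √q ≤ 2 * √p) h4]

end RiemannStieltjes

/-! ### Construction of `∫ σ dB` with paths continuous up to time 1. -/

section Existence

variable {Ω : Type*} [MeasurableSpace Ω] {P : Measure Ω} {B M : ℝ≥0 → Ω → ℝ}
  {hB : IsPreBrownianReal B P} {h σ : ℝ → ℝ} {S : ℝ}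

lemma integral_abs_le_sqrt_integral_sq [IsProbabilityMeasure P] {Y : Ω → ℝ} (hY : MemLp Y 2 P) :
    ∫ ω, |Y ω| ∂P ≤ √(∫ ω, Y ω ^ 2 ∂P) := by
  have h1 := variance_eq_sub hY.abs
  have h2 := variance_nonneg |Y| P
  rw [h1] at h2
  refine Real.le_sqrt_of_sq_le ?_
  simpa [sub_nonneg] using h2

/-- Fatou's lemma. Taking `R` to be Riemann sums gives measurability of a pathwise integral without
joint measurability of the integrand. -/
lemma aemeasurable_and_lintegral_le_of_tendsto {R : ℕ → Ω → ℝ} {I : Ω → ℝ} {C : ℝ}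
    (hR : ∀ n, Integrable (R n) P) (hR0 : ∀ n ω, 0 ≤ R n ω) (hC : ∀ n, ∫ ω, R n ω ∂P ≤ C)
    (hlim : ∀ᵐ ω ∂P, Tendsto (fun n ↦ R n ω) atTop (𝓝 (I ω))) :
    AEMeasurable I P ∧ ∫⁻ ω, ENNReal.ofReal (I ω) ∂P ≤ ENNReal.ofReal C := by
  refine ⟨aemeasurable_of_tendsto_metrizable_ae atTop (fun n ↦ (hR n).aemeasurable) hlim, ?_⟩
  calc ∫⁻ ω, ENNReal.ofReal (I ω) ∂P
      = ∫⁻ ω, liminf (fun n ↦ ENNReal.ofReal (R n ω)) atTop ∂P := by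
        refine lintegral_congr_ae ?_
        filter_upwards [hlim] with ω hω
        exact ((ENNReal.continuous_ofReal.tendsto _).comp hω).liminf_eq.symm
    _ ≤ liminf (fun n ↦ ∫⁻ ω, ENNReal.ofReal (R n ω) ∂P) atTop :=
        lintegral_liminf_le' fun n ↦ (hR n).aemeasurable.ennreal_ofReal
    _ ≤ ENNReal.ofReal C := by
        refine (liminf_le_liminf (.of_forall fun n ↦ ?_)).trans (liminf_const _).le
        rw [← ofReal_integral_eq_lintegral_ofReal (hR n) (.of_forall (hR0 n))]
        exact ENNReal.ofReal_le_ofReal (hC n)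

/-- The point is that the bound does not depend on `t < 1`: it comes from `E|M_r| ≤ √(S/φ(r))` and a
telescoping sum of `√φ`. -/
lemma lintegral_ofReal_integral_le (hh : ContinuousOn h (Set.Ico 0 1))
    (hM : ∀ t : ℝ≥0, t < 1 → HasRep hB (M t)
      ((Set.Ico (0 : ℝ) t).indicator fun r ↦ σ r / phi h r))
    (hMc : ∀ᵐ ω ∂P, ContinuousOn (fun t ↦ M t ω) (Set.Iio 1)) (hS : 0 ≤ S)
    (hw : ∀ t ∈ Set.Ico (0 : ℝ) 1, 0 ≤ h t * phi h t)
    (hφ : ∀ a b : ℝ, 0 ≤ a → a ≤ b → b < 1 → ∫ r in a..b, h r * phi h r = phi h a - phi h b)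
    (hV : ∀ t : ℝ≥0, t < 1 → ∫ r in (0 : ℝ)..t, (σ r / phi h r) ^ 2 = S * (1 / phi h t - 1))
    {t : ℝ≥0} (ht : t < 1) :
    AEMeasurable (fun ω ↦ ∫ r in (0 : ℝ)..t, |M r.toNNReal ω| * (h r * phi h r)) P ∧
    ∫⁻ ω, ENNReal.ofReal (∫ r in (0 : ℝ)..t, |M r.toNNReal ω| * (h r * phi h r)) ∂P
      ≤ ENNReal.ofReal (2 * √S) := by
  have := hB.isGaussianProcess.isProbabilityMeasure
  have hmono {a b : ℝ} (ha : 0 ≤ a) (hab : a ≤ b) (hb : b < 1) : phi h b ≤ phi h a := by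
    have := hφ a b ha hab hb
    have := intervalIntegral.integral_nonneg (μ := volume) (f := fun r ↦ h r * phi h r) hab
      fun r hr ↦ hw r ⟨ha.trans hr.1, hr.2.trans_lt hb⟩
    linarith
  have hg1 (n k : ℕ) : (grid t n k : ℝ) ≤ grid t n (k + 1) := by
    exact_mod_cast grid_mono t n k.le_succ
  have hg2 {n k : ℕ} (hk : k ≤ n) : grid t n k < 1 := (grid_le t hk).trans_lt ht
  have hφk {n k : ℕ} (hk : k < n) : phi h (grid t n (k + 1)) ≤ phi h (grid t n k) :=
    hmono (grid t n k).coe_nonneg (hg1 n k) (by exact_mod_cast hg2 hk)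
  have hterm {n k : ℕ} (hk : k < n) : Integrable (fun ω ↦ |M (grid t n k) ω|) P :=
    ((hM _ (hg2 hk.le)).memLp.integrable (by norm_num)).abs
  refine aemeasurable_and_lintegral_le_of_tendsto
    (R := fun n ω ↦ ∑ k ∈ Finset.range n, |M (grid t n k) ω| *
      (phi h (grid t n k) - phi h (grid t n (k + 1)))) (fun n ↦ ?_) (fun n ω ↦ ?_) (fun n ↦ ?_) ?_
  · exact integrable_finsetSum _ fun k hk ↦ (hterm (Finset.mem_range.1 hk)).mul_const _
  · exact Finset.sum_nonneg fun k hk ↦ mul_nonneg (abs_nonneg _)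
      (sub_nonneg.2 (hφk (Finset.mem_range.1 hk)))
  · rw [integral_finsetSum _ fun k hk ↦ (hterm (Finset.mem_range.1 hk)).mul_const _]
    simp_rw [integral_mul_const]
    calc ∑ k ∈ Finset.range n, (∫ ω, |M (grid t n k) ω| ∂P) *
          (phi h (grid t n k) - phi h (grid t n (k + 1)))
        ≤ ∑ k ∈ Finset.range n,
          2 * √S * (√(phi h (grid t n k)) - √(phi h (grid t n (k + 1)))) := by
          refine Finset.sum_le_sum fun k hk ↦ ?_
          have hk' := Finset.mem_range.1 hk
          have hm := hM _ (hg2 hk'.le)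
          have hv := hm.integral_mul hm
          rw [integral_indicator_Ico_mul_indicator _ le_rfl, hV _ (hg2 hk'.le)] at hv
          simp only [← sq] at hv
          refine le_trans ?_ (sub_mul_sqrt_div_le hS (phi_pos h _) (phi_pos h _).le (hφk hk'))
          refine mul_le_mul_of_nonneg_right ?_ (sub_nonneg.2 (hφk hk'))
          -- Here `E M² = S (1/φ - 1) ≤ S/φ`.
          refine (integral_abs_le_sqrt_integral_sq hm.memLp).trans (Real.sqrt_le_sqrt ?_)
          rw [hv, div_eq_mul_one_div S]
          exact mul_le_mul_of_nonneg_left (by linarith) hS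
      _ = 2 * √S * (√(phi h (grid t n 0)) - √(phi h (grid t n n))) := by
          rw [← Finset.mul_sum, Finset.sum_range_sub' (fun k ↦ √(phi h (grid t n k)))]
      _ ≤ 2 * √S := by
          rw [grid_zero, NNReal.coe_zero, phi_zero, Real.sqrt_one]
          nlinarith [Real.sqrt_nonneg S, Real.sqrt_nonneg (phi h (grid t n n)),
            mul_nonneg (Real.sqrt_nonneg S) (Real.sqrt_nonneg (phi h (grid t n n)))]
  · filter_upwards [hMc] with ω hω
    have h1 := tendsto_sum_mul_integral (t := t) (F := fun r ↦ |M r.toNNReal ω|)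
      (w := fun r ↦ h r * phi h r) (((continuousOn_comp_toNNReal hω).mono fun x hx ↦
        hx.2.trans_lt (by exact_mod_cast ht)).abs) (hh.mul (continuousOn_phi hh)) ht
    refine h1.congr fun n ↦ Finset.sum_congr rfl fun k hk ↦ ?_
    rw [hφ _ _ (grid t n k).coe_nonneg (hg1 n k)
      (by exact_mod_cast hg2 (Finset.mem_range.1 hk)), Real.toNNReal_coe]

lemma ae_intervalIntegrable_mul (hh : ContinuousOn h (Set.Ico 0 1))
    (hM : ∀ t : ℝ≥0, t < 1 → HasRep hB (M t)
      ((Set.Ico (0 : ℝ) t).indicator fun r ↦ σ r / phi h r))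
    (hMc : ∀ᵐ ω ∂P, ContinuousOn (fun t ↦ M t ω) (Set.Iio 1)) (hS : 0 ≤ S)
    (hw : ∀ t ∈ Set.Ico (0 : ℝ) 1, 0 ≤ h t * phi h t)
    (hφ : ∀ a b : ℝ, 0 ≤ a → a ≤ b → b < 1 → ∫ r in a..b, h r * phi h r = phi h a - phi h b)
    (hV : ∀ t : ℝ≥0, t < 1 → ∫ r in (0 : ℝ)..t, (σ r / phi h r) ^ 2 = S * (1 / phi h t - 1)) :
    ∀ᵐ ω ∂P, IntervalIntegrable (fun r ↦ M r.toNNReal ω * (h r * phi h r)) volume 0 1 := by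
  have hτ := tendsto_natCast_div_add_one_nnreal
  set τ : ℕ → ℝ≥0 := fun n ↦ (n : ℝ≥0) / (n + 1) with hτ_def
  have hτ1 (n : ℕ) : τ n < 1 := by
    rw [hτ_def, div_lt_one (by positivity)]
    exact lt_add_one _
  have hτm : Monotone τ := by
    intro a b hab
    simp only [hτ_def]
    rw [div_le_div_iff₀ (by positivity) (by positivity)]
    have : (a : ℝ≥0) ≤ b := by exact_mod_cast hab
    nlinarith
  have key := fun n ↦ lintegral_ofReal_integral_le hh hM hMc hS hw hφ hV (hτ1 n)
  have hfat : ∫⁻ ω, liminf (fun n ↦ ENNReal.ofReal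
      (∫ r in (0 : ℝ)..τ n, |M r.toNNReal ω| * (h r * phi h r))) atTop ∂P
        ≤ ENNReal.ofReal (2 * √S) := by
    refine (lintegral_liminf_le' fun n ↦ (key n).1.ennreal_ofReal).trans ?_
    exact (liminf_le_liminf (.of_forall fun n ↦ (key n).2)).trans (liminf_const _).le
  have hmeas : AEMeasurable (fun ω ↦ liminf (fun n ↦ ENNReal.ofReal
      (∫ r in (0 : ℝ)..τ n, |M r.toNNReal ω| * (h r * phi h r))) atTop) P := by
    simp only [liminf_eq_iSup_iInf_of_nat]
    exact .iSup fun n ↦ .biInf _ (Set.to_countable _) fun k _ ↦ (key k).1.ennreal_ofReal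
  have hfin := ae_lt_top' hmeas (hfat.trans_lt ENNReal.ofReal_lt_top).ne
  filter_upwards [hfin, hMc] with ω hω hc
  have hcw : ContinuousOn (fun r ↦ M r.toNNReal ω * (h r * phi h r)) (Set.Ico 0 1) :=
    ((continuousOn_comp_toNNReal hc).mono fun x hx ↦ hx.2).mul (hh.mul (continuousOn_phi hh))
  have hmem (n : ℕ) : (τ n : ℝ) ∈ Set.Ico (0 : ℝ) 1 := coe_mem_Ico le_rfl (hτ1 n)
  have hi (n : ℕ) : IntervalIntegrable (fun r ↦ M r.toNNReal ω * (h r * phi h r)) volume 0 (τ n) :=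
    intervalIntegrable_of_continuousOn_Ico hcw (by simp) (hmem n)
  have hnorm (n : ℕ) : ∫ r in (0 : ℝ)..τ n, ‖M r.toNNReal ω * (h r * phi h r)‖ =
      ∫ r in (0 : ℝ)..τ n, |M r.toNNReal ω| * (h r * phi h r) := by
    refine intervalIntegral.integral_congr fun r hr ↦ ?_
    rw [Set.uIcc_of_le (hmem n).1] at hr
    rw [Real.norm_eq_abs, abs_mul, abs_of_nonneg (hw r ⟨hr.1, hr.2.trans_lt (hmem n).2⟩)]
  obtain ⟨C, hC1, hC2⟩ := exists_between hω
  have hfreq := frequently_lt_of_liminf_lt (by isBoundedDefault) hC1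
  rw [intervalIntegrable_iff_integrableOn_Ioc_of_le zero_le_one]
  refine integrableOn_Ioc_of_intervalIntegral_norm_bounded_right (I := C.toReal)
    (b := fun n ↦ (τ n : ℝ)) (l := atTop) (fun n ↦ ?_) ?_ (.of_forall fun n ↦ ?_)
  · exact (intervalIntegrable_iff_integrableOn_Ioc_of_le (hmem n).1).1 (hi n)
  · exact (tendsto_coe_nhdsLT_one.comp hτ).mono_right nhdsWithin_le_nhds
  · rw [← intervalIntegral.integral_of_le (hmem n).1]
    -- A finite liminf bounds the integrals for infinitely many `m`; monotonicity in the upper limit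
    -- extends the bound to every `n`.
    obtain ⟨m, hm1, hm2⟩ := (hfreq.and_eventually (eventually_ge_atTop n)).exists
    have h1 : ∫ r in (0 : ℝ)..τ n, ‖M r.toNNReal ω * (h r * phi h r)‖ ≤
        ∫ r in (0 : ℝ)..τ m, ‖M r.toNNReal ω * (h r * phi h r)‖ :=
      intervalIntegral.integral_mono_interval le_rfl (hmem n).1
        (by exact_mod_cast hτm hm2) (.of_forall fun _ ↦ norm_nonneg _) (hi m).norm
    refine h1.trans ?_
    rw [hnorm m]
    exact (ENNReal.ofReal_le_iff_le_toReal hC2.ne).1 hm1.le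

/-- The Wiener integral of `σ`, obtained from that of `σ / φ` by integration by parts. -/
noncomputable def wienerByParts {Ω : Type*} (h : ℝ → ℝ) (M : ℝ≥0 → Ω → ℝ) (t : ℝ≥0) (ω : Ω) : ℝ :=
  (if t < 1 then phi h t * M t ω else 0) +
    ∫ r in (0 : ℝ)..t, M r.toNNReal ω * (h r * phi h r)

lemma continuousOn_wienerByParts {Ω : Type*} {M : ℝ≥0 → Ω → ℝ} {ω : Ω}
    (hc : ContinuousOn (fun t : ℝ≥0 ↦ phi h t * M t ω) (Set.Iio 1))
    (hlim : Tendsto (fun t : ℝ≥0 ↦ phi h t * M t ω) (𝓝[<] 1) (𝓝 0))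
    (hi : IntervalIntegrable (fun r ↦ M r.toNNReal ω * (h r * phi h r)) volume 0 1) :
    ContinuousOn (fun t ↦ wienerByParts h M t ω) (Set.Iic 1) := by
  refine (continuousOn_ite_lt_one hc hlim).add ?_
  have h1 := intervalIntegral.continuousOn_primitive_interval' hi Set.left_mem_uIcc
  rw [Set.uIcc_of_le zero_le_one] at h1
  exact h1.comp NNReal.continuous_coe.continuousOn
    fun t ht ↦ ⟨t.coe_nonneg, by exact_mod_cast (show t ≤ 1 from ht)⟩

/-- The sums `∑ φ(t_{k+1}) (M_{t_{k+1}} - M_{t_k})` converge pathwise to the by-parts expression,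
while their integrands converge in `L²` to `φ · σ/φ = σ` on `[0, t)`. -/
lemma hasRep_wienerByParts (hh : ContinuousOn h (Set.Ico 0 1)) (hσ : ContinuousOn σ (Set.Ico 0 1))
    (hM : ∀ t : ℝ≥0, t < 1 → HasRep hB (M t)
      ((Set.Ico (0 : ℝ) t).indicator fun r ↦ σ r / phi h r))
    (hMc : ∀ᵐ ω ∂P, ContinuousOn (fun t ↦ M t ω) (Set.Iio 1))
    (hφ : ∀ a b : ℝ, 0 ≤ a → a ≤ b → b < 1 → ∫ r in a..b, h r * phi h r = phi h a - phi h b)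
    {t : ℝ≥0} (ht : t < 1) :
    HasRep hB (wienerByParts h M t) ((Set.Ico (0 : ℝ) t).indicator σ) := by
  have hM0 : M 0 =ᵐ[P] 0 := by
    refine (hM 0 zero_lt_one).ae_eq ((hasRep_zero (hB := hB)).congr .rfl ?_)
    simp
    rfl
  have hlim := tendsto_eLpNorm_stepFn_mul (continuousOn_Icc_of_lt (continuousOn_phi hh) ht)
    (continuousOn_Icc_of_lt (continuousOn_div_phi hh hσ) ht) (right_mem_cell t)
  have hsimp : (fun x ↦ phi h x * (σ x / phi h x)) = σ := by
    ext x
    rw [mul_div_cancel₀ _ (phi_pos h x).ne']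
  rw [hsimp] at hlim
  refine HasRep.of_tendsto_ae (fun n ↦ hasRep_sum_increments
    (fun s hs ↦ hM s (hs.trans_lt ht)) n fun k ↦ phi h (grid t n (k + 1)))
    (memLp_indicator_of_continuousOn (continuousOn_Icc_of_lt hσ ht)) ?_ hlim
  filter_upwards [hMc, hM0] with ω hc h0
  rw [wienerByParts, if_pos ht]
  exact tendsto_sum_right_increments hc h0 (hh.mul (continuousOn_phi hh)) hφ ht

end Existence

/-! ### From the bridge property to the bridge condition. -/

section Necessity

variable {Ω Ω' : Type*} [MeasurableSpace Ω] [MeasurableSpace Ω'] {P : Measure Ω} {P' : Measure Ω'}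
  {M : ℝ≥0 → Ω → ℝ} {Z : ℝ → ℝ≥0 → Ω' → ℝ} {h σ : ℝ → ℝ}

/-- `X^{10} - X^{00} = φ` is deterministic, so a single good `ω` suffices. -/
lemma tendsto_phi_of_isPinned [IsProbabilityMeasure P] (hpin : IsPinned (diffusion h M) P) :
    Tendsto (phi h) (𝓝[<] 1) (𝓝 0) := by
  obtain ⟨ω, h0, h1⟩ := ((hpin 0 0).and (hpin 1 0)).exists
  have h2 := h1.sub h0
  simp only [diffusion, mul_one, mul_zero, add_zero, zero_add, add_sub_cancel_right, sub_self]
    at h2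
  have h3 : Tendsto Real.toNNReal (𝓝[<] 1) (𝓝[<] 1) := by
    refine tendsto_nhdsWithin_iff.2 ⟨?_, ?_⟩
    · have := (continuous_real_toNNReal.tendsto 1).mono_left (nhdsWithin_le_nhds (s := Set.Iio 1))
      rwa [Real.toNNReal_one] at this
    · filter_upwards [self_mem_nhdsWithin] with t ht using Real.toNNReal_lt_one.2 ht
  refine (h2.comp h3).congr' ?_
  filter_upwards [Ioo_mem_nhdsLT (zero_lt_one (α := ℝ))] with t ht
  simp [Real.coe_toNNReal t ht.1.le]

/-- The bridge property at the times in `J` determines the regression of `Z` on `Z_1`. -/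
lemma AreBridges.indepFun [IsProbabilityMeasure P] [IsProbabilityMeasure P']
    (hbr : AreBridges (diffusion h M) P Z P') (J : Finset ℝ≥0) (hJ : ∀ t ∈ J, t < 1) :
    HasLaw (fun ω (t : J) ↦ Z 0 t ω - (1 - phi h t) * Z 0 1 ω)
      (P.map fun ω (t : J) ↦ phi h t * M t ω) P' ∧
    IndepFun (Z 0 1) (fun ω (t : J) ↦ Z 0 t ω - (1 - phi h t) * Z 0 1 ω) P' := by
  obtain ⟨κ, hκ, hlaw⟩ := hbr 0 J hJ
  have h0 : (fun ω ↦ J.restrict fun t ↦ diffusion h M 0 0 t ω) =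
      fun ω (t : J) ↦ phi h t * M t ω := by
    ext ω t
    simp [diffusion]
  have hX := (hlaw 0).aemeasurable
  rw [h0] at hX
  have := Measure.isProbabilityMeasure_map hX
  have hψ : Measurable fun (y : ℝ) (t : J) ↦ (1 - phi h t) * y := by fun_prop
  -- The law of `X^{0y}` is prescribed for every `y`, so the kernels are equal everywhere, not just
  -- almost everywhere.
  have hκ' : κ = shiftKernel (P.map fun ω (t : J) ↦ phi h t * M t ω)
      (fun (y : ℝ) (t : J) ↦ (1 - phi h t) * y) hψ := by
    ext1 y
    rw [shiftKernel_apply, ← (hlaw y).map_eq,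
      AEMeasurable.map_map_of_aemeasurable (by fun_prop) hX]
    congr 1 with ω t
    simp only [Finset.restrict, Function.comp_apply, Pi.add_apply, diffusion]
    ring
  have hc := hκ.hasCondDistrib
  rw [hκ'] at hc
  exact HasCondDistrib.indepFun_sub hψ hc

variable {B : ℝ≥0 → Ω → ℝ} {hB : IsPreBrownianReal B P}

lemma IsGaussianMarkov.hasGaussianLaw_prodMk (hZ : IsGaussianMarkov Z P') {s t : ℝ≥0}
    (hs : s ≤ 1) (ht : t ≤ 1) : HasGaussianLaw (fun ω ↦ (Z 0 s ω, Z 0 t ω)) P' :=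
  (hZ.gaussian 0).hasGaussianLaw_prodMk (s := ⟨s, hs⟩) (t := ⟨t, ht⟩)

lemma IsGaussianMarkov.memLp (hZ : IsGaussianMarkov Z P') {t : ℝ≥0} (ht : t ≤ 1) :
    MemLp (Z 0 t) 2 P' :=
  ((hZ.gaussian 0).hasGaussianLaw_eval ⟨t, ht⟩).memLp_two

lemma AreBridges.covariance_one [IsProbabilityMeasure P] [IsProbabilityMeasure P']
    (hbr : AreBridges (diffusion h M) P Z P') (hZ : IsGaussianMarkov Z P') {t : ℝ≥0} (ht : t < 1) :
    cov[Z 0 t, Z 0 1; P'] = (1 - phi h t) * variance (Z 0 1) P' := by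
  have hm1 := hZ.memLp le_rfl
  have hmt := hZ.memLp ht.le
  have heval : Measurable fun z : ({t} : Finset ℝ≥0) → ℝ ↦ z ⟨t, by simp⟩ :=
    measurable_pi_apply _
  have hind := (hbr.indepFun {t} (by simpa using ht)).2.comp measurable_id heval
  have hm : MemLp (Z 0 t - (1 - phi h t) • Z 0 1) 2 P' := hmt.sub (hm1.const_smul _)
  have hcov : cov[Z 0 1, Z 0 t - (1 - phi h t) • Z 0 1; P'] = 0 :=
    IndepFun.covariance_eq_zero hind hm1 hm
  rw [covariance_sub_right hm1 hmt (hm1.const_smul _), covariance_smul_right,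
    covariance_self hm1.aemeasurable, covariance_comm] at hcov
  linarith

lemma AreBridges.covariance [IsProbabilityMeasure P] [IsProbabilityMeasure P']
    (hbr : AreBridges (diffusion h M) P Z P') (hZ : IsGaussianMarkov Z P')
    (hM : ∀ t : ℝ≥0, t < 1 → HasRep hB (M t)
      ((Set.Ico (0 : ℝ) t).indicator fun r ↦ σ r / phi h r))
    {s t : ℝ≥0} (hst : s ≤ t) (ht : t < 1) :
    cov[Z 0 s, Z 0 t; P'] = phi h s * phi h t * (∫ r in (0 : ℝ)..s, (σ r / phi h r) ^ 2) +
      (1 - phi h s) * (1 - phi h t) * variance (Z 0 1) P' := by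
  have hs := hst.trans_lt ht
  have m1 := hZ.memLp le_rfl
  have ms := hZ.memLp hs.le
  have mt := hZ.memLp ht.le
  have hJ : ∀ r ∈ ({s, t} : Finset ℝ≥0), r < 1 := by
    intro r hr
    rcases Finset.mem_insert.1 hr with rfl | hr
    · exact hs
    · exact (Finset.mem_singleton.1 hr).trans_lt ht
  have hW := (hbr.indepFun {s, t} hJ).1
  have hX : HasLaw (fun ω (r : ({s, t} : Finset ℝ≥0)) ↦ phi h r * M r ω)
      (P.map fun ω (r : ({s, t} : Finset ℝ≥0)) ↦ phi h r * M r ω) P :=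
    ⟨aemeasurable_pi_lambda _ fun r ↦ (hM r (hJ r r.2)).memLp.aemeasurable.const_mul _, rfl⟩
  have e1 := hW.covariance_fun_comp (f := fun z ↦ z ⟨s, by simp⟩) (g := fun z ↦ z ⟨t, by simp⟩)
    (measurable_pi_apply _).aemeasurable (measurable_pi_apply _).aemeasurable
  have e2 := hX.covariance_fun_comp (f := fun z ↦ z ⟨s, by simp⟩) (g := fun z ↦ z ⟨t, by simp⟩)
    (measurable_pi_apply _).aemeasurable (measurable_pi_apply _).aemeasurable
  -- The residuals of `Z` have the same joint law as `φ M`; expanding bilinearly isolates `cov(Z_s,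
  -- Z_t)`.
  have e3 : cov[Z 0 s - (1 - phi h s) • Z 0 1, Z 0 t - (1 - phi h t) • Z 0 1; P'] =
      cov[phi h s • M s, phi h t • M t; P] := e1.trans e2.symm
  rw [covariance_sub_left ms (m1.const_smul _) (mt.sub (m1.const_smul _)),
    covariance_sub_right ms mt (m1.const_smul _),
    covariance_sub_right (m1.const_smul _) mt (m1.const_smul _),
    covariance_smul_left, covariance_smul_left, covariance_smul_right, covariance_smul_right,
    covariance_smul_left, covariance_smul_right, covariance_min_of_hasRep (hM s hs) (hM t ht),
    min_eq_left hst, hbr.covariance_one hZ hs, covariance_comm (Z 0 1),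
    hbr.covariance_one hZ ht, covariance_self m1.aemeasurable] at e3
  linarith

/-- The covariance of a Gaussian Markov process factorizes through intermediate times. -/
lemma IsGaussianMarkov.covariance_mul_covariance [IsProbabilityMeasure P']
    (hZ : IsGaussianMarkov Z P') {s t : ℝ≥0} (hst : s ≤ t) (ht0 : 0 < t) (ht : t ≤ 1) :
    cov[Z 0 s, Z 0 1; P'] * variance (Z 0 t) P' = cov[Z 0 t, Z 0 1; P'] * cov[Z 0 s, Z 0 t; P'] := by
  obtain ⟨κ, hκ⟩ := hZ.markov
  obtain ⟨_, hcd⟩ := hκ t 1 ht le_rfl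
  have hm1 := hZ.memLp le_rfl
  have hmt := hZ.memLp ht
  have hms := hZ.memLp (hst.trans ht)
  have hv := hZ.nondegenerate 0 t ht0 ht
  -- The regression coefficient of `Z_1` on `Z_t`: the residual is independent of `Z_t` by
  -- Gaussianity, and then of the past value `Z_s` by the Markov property.
  set b := cov[Z 0 t, Z 0 1; P'] / variance (Z 0 t) P' with hb
  have hG : HasGaussianLaw (fun ω ↦ (Z 0 t ω, Z 0 1 ω - b * Z 0 t ω)) P' :=
    (hZ.hasGaussianLaw_prodMk ht le_rfl).map
      ((ContinuousLinearMap.fst ℝ ℝ ℝ).prod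
        (ContinuousLinearMap.snd ℝ ℝ ℝ - b • ContinuousLinearMap.fst ℝ ℝ ℝ))
  have hind : IndepFun (Z 0 t) (fun ω ↦ Z 0 1 ω - b * Z 0 t ω) P' := by
    refine hG.indepFun_of_covariance_eq_zero ?_
    change cov[Z 0 t, Z 0 1 - b • Z 0 t; P'] = 0
    rw [covariance_sub_right hmt hm1 (hmt.const_smul _), covariance_smul_right,
      covariance_self hmt.aemeasurable, hb]
    field_simp
    ring
  have hind2 := indepFun_prodMk_of_hasCondDistrib_prodMkRight (ψ := fun z ↦ b * z)
    (by fun_prop) (hcd 0 {s} (by simpa using hst)) hind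
  have hind3 := hind2.comp (φ := fun p : ℝ × (({s} : Finset ℝ≥0) → ℝ) ↦ p.2 ⟨s, by simp⟩)
    (ψ := id) (by fun_prop) measurable_id
  have hcov : cov[Z 0 s, Z 0 1 - b • Z 0 t; P'] = 0 :=
    IndepFun.covariance_eq_zero hind3 hms (hm1.sub (hmt.const_smul b))
  rw [covariance_sub_right hms hm1 (hmt.const_smul _), covariance_smul_right, sub_eq_zero] at hcov
  rw [hcov, hb]
  field_simp

/-- A function `φ` with `1 / φ - 1` proportional to `∫ σ² / φ²` satisfies the bridge condition. -/
lemma bridgeCondition_of_phi (hh : ContinuousOn h (Set.Ico 0 1)) (hσ : ContinuousOn σ (Set.Ico 0 1))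
    (hphi : Tendsto (phi h) (𝓝[<] 1) (𝓝 0)) {c : ℝ}
    (hc : ∀ t ∈ Set.Ioo (0 : ℝ) 1,
      (phi h t)⁻¹ - 1 = c * ∫ r in (0 : ℝ)..t, (σ r / phi h r) ^ 2) :
    BridgeCondition h σ := by
  have hφc := continuousOn_phi hh
  have hderiv : ∀ t ∈ Set.Ioo (0 : ℝ) 1, h t * phi h t = c * σ t ^ 2 := by
    intro t ht
    have h1 := ((hasDerivAt_phi hh ht).inv (phi_pos h t).ne').sub_const 1
    have h2 := (hasDerivAt_primitive (q := fun r ↦ (σ r / phi h r) ^ 2)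
      ((continuousOn_div_phi hh hσ).pow 2) ht).const_mul c
    have h3 := h1.unique (h2.congr_of_eventuallyEq (by
      filter_upwards [Ioo_mem_nhds ht.1 ht.2] with r hr using hc r hr))
    have := (phi_pos h t).ne'
    field_simp at h3
    linarith
  have heq : ∀ t ∈ Set.Ico (0 : ℝ) 1, h t * phi h t = c * σ t ^ 2 := by
    intro t ht
    rcases ht.1.eq_or_lt with rfl | h0
    -- Two-sided derivatives exist only inside the interval; the identity reaches 0 by one-sided
    -- continuity.
    · have hne : (𝓝[Set.Ioo 0 1] (0 : ℝ)).NeBot := left_nhdsWithin_Ioo_neBot one_pos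
      have h1 := (((hh.mul hφc) 0 ht).mono Set.Ioo_subset_Ico_self).tendsto
      have h2 := (((continuousOn_const (c := c)).mul (hσ.pow 2) 0 ht).mono
        Set.Ioo_subset_Ico_self).tendsto
      refine tendsto_nhds_unique_of_eventuallyEq h1 h2 ?_
      filter_upwards [self_mem_nhdsWithin] with r hr using hderiv r hr
    · exact hderiv t ⟨h0, ht.2⟩
  have hint : ∀ t ∈ Set.Ico (0 : ℝ) 1, c * ∫ r in (0 : ℝ)..t, σ r ^ 2 = 1 - phi h t := by
    intro t ht
    have h1 := integral_eq_sub_of_hasDerivAt_Ioo (q := fun r ↦ h r * phi h r)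
      (F := fun r ↦ -phi h r) (hh.mul hφc) hφc.neg
      (fun x hx ↦ (hasDerivAt_phi hh hx).neg.congr_deriv (neg_neg _)) le_rfl ht.1 ht.2
    rw [phi_zero] at h1
    rw [← intervalIntegral.integral_const_mul, ← intervalIntegral.integral_congr
      (f := fun r ↦ h r * phi h r), h1]
    · ring
    · intro r hr
      rw [Set.uIcc_of_le ht.1] at hr
      exact heq r ⟨hr.1, hr.2.trans_lt ht.2⟩
  have hev : ∀ᶠ t in 𝓝[<] (1 : ℝ), c * ∫ r in (0 : ℝ)..t, σ r ^ 2 = 1 - phi h t := by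
    filter_upwards [Ioo_mem_nhdsLT (zero_lt_one (α := ℝ))] with t ht
      using hint t ⟨ht.1.le, ht.2⟩
  have hlim : Tendsto (fun t ↦ c * ∫ r in (0 : ℝ)..t, σ r ^ 2) (𝓝[<] 1) (𝓝 1) := by
    have := (tendsto_const_nhds (x := (1 : ℝ))).sub hphi
    rw [sub_zero] at this
    exact this.congr' (hev.mono fun _ ht ↦ ht.symm)
  have hc0 : c ≠ 0 := by
    rintro rfl
    simp only [zero_mul] at hlim
    exact zero_ne_one (tendsto_nhds_unique tendsto_const_nhds hlim)
  -- Since `c ∫₀ᵗ σ² = 1 - φ(t) → 1`, the limit `Σ` must be `1 / c`.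
  refine ⟨c⁻¹, ?_, fun t ht ↦ ?_⟩
  · have := hlim.const_mul c⁻¹
    simpa only [inv_mul_cancel_left₀ hc0, mul_one] using this
  · have h1 : c⁻¹ - ∫ r in (0 : ℝ)..t, σ r ^ 2 = phi h t / c := by
      have := hint t ht
      field_simp
      linarith
    have := (phi_pos h t).ne'
    rw [h1]
    field_simp
    linarith [heq t ht]

lemma AreBridges.bridgeCondition [IsProbabilityMeasure P] [IsProbabilityMeasure P']
    (hbr : AreBridges (diffusion h M) P Z P') (hZ : IsGaussianMarkov Z P')
    (hh : ContinuousOn h (Set.Ico 0 1)) (hσ : ContinuousOn σ (Set.Ico 0 1))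
    (hpos : ∀ t ∈ Set.Ico (0 : ℝ) 1, 0 < σ t)
    (hM : ∀ t : ℝ≥0, t < 1 → HasRep hB (M t)
      ((Set.Ico (0 : ℝ) t).indicator fun r ↦ σ r / phi h r))
    (hpin : IsPinned (diffusion h M) P) :
    BridgeCondition h σ := by
  set V : ℝ → ℝ := fun t ↦ ∫ r in (0 : ℝ)..t, (σ r / phi h r) ^ 2 with hVdef
  have hV {t : ℝ} (ht : t ∈ Set.Ioo (0 : ℝ) 1) : 0 < V t :=
    integral_sq_pos (continuousOn_div_phi hh hσ)
      (fun r hr ↦ div_pos (hpos r hr) (phi_pos h r)) le_rfl ht.1 ht.2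
  have hC := hZ.nondegenerate 0 1 one_pos le_rfl
  have key {s t : ℝ≥0} (hst : s ≤ t) (h0 : 0 < t) (ht : t < 1) :
      (1 - phi h s) * (phi h t * V t) = (1 - phi h t) * (phi h s * V s) := by
    have h1 := hZ.covariance_mul_covariance hst h0 ht.le
    rw [← covariance_self (hZ.memLp ht.le).aemeasurable, hbr.covariance hZ hM le_rfl ht,
      hbr.covariance hZ hM hst ht, hbr.covariance_one hZ ht,
      hbr.covariance_one hZ (hst.trans_lt ht)] at h1
    -- In the factorization identity the terms quadratic in `Var Z_1` cancel.
    have h2 : (variance (Z 0 1) P' * phi h t) * ((1 - phi h s) * (phi h t * V t)) =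
        (variance (Z 0 1) P' * phi h t) * ((1 - phi h t) * (phi h s * V s)) := by
      simp only [hVdef]
      linear_combination h1
    exact mul_left_cancel₀ (mul_pos hC (phi_pos h t)).ne' h2
  -- Any reference time in `(0, 1)` would do: `(1 - φ) / (φ V)` is constant there, and its value at
  -- `u` is the constant `c`.
  set u : ℝ≥0 := 1 / 2
  have hu0 : 0 < u := by positivity
  have hu1 : u < 1 := by
    rw [← NNReal.coe_lt_coe]
    norm_num [u]
  have huV := hV ⟨NNReal.coe_pos.2 hu0, by exact_mod_cast hu1⟩
  refine bridgeCondition_of_phi (c := (1 - phi h u) / (phi h u * V u)) hh hσ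
    (tendsto_phi_of_isPinned hpin) fun t ht ↦ ?_
  lift t to ℝ≥0 using ht.1.le
  have ht1 : t < 1 := by exact_mod_cast ht.2
  have ht0 : 0 < t := by exact_mod_cast ht.1
  have h1 : (1 - phi h u) * (phi h t * V t) = (1 - phi h t) * (phi h u * V u) := by
    rcases le_total u t with hut | hut
    · exact key hut ht0 ht1
    · exact (key hut hu0 hu1).symm
  have p1 := phi_pos h u
  have p2 := phi_pos h t
  change (phi h t)⁻¹ - 1 = (1 - phi h u) / (phi h u * V u) * V t
  field_simp
  linarith

end Necessity

/-! ### Consequences of the bridge condition, assembled. -/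

section BridgeCondition

variable {Ω : Type*} [MeasurableSpace Ω] {P : Measure Ω} {B M N : ℝ≥0 → Ω → ℝ}
  {hB : IsPreBrownianReal B P} {h σ : ℝ → ℝ}

lemma BridgeCondition.exists_isWienerIntegral (hbc : BridgeCondition h σ)
    (hh : ContinuousOn h (Set.Ico 0 1)) (hσ : ContinuousOn σ (Set.Ico 0 1))
    (hpos : ∀ t ∈ Set.Ico (0 : ℝ) 1, 0 < σ t)
    (hM : ∀ t : ℝ≥0, t < 1 → HasRep hB (M t)
      ((Set.Ico (0 : ℝ) t).indicator fun r ↦ σ r / phi h r))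
    (hMc : ∀ᵐ ω ∂P, ContinuousOn (fun t ↦ M t ω) (Set.Iio 1))
    (hpin : IsPinned (diffusion h M) P) :
    ∃ N : ℝ≥0 → Ω → ℝ, IsWienerIntegral σ B N P ∧
      ∀ᵐ ω ∂P, ContinuousOn (fun t ↦ N t ω) (Set.Iic 1) := by
  obtain ⟨S, hS, hhS⟩ := hbc
  have hS0 : 0 < S := by simpa using integral_sq_lt_of_tendsto hσ hpos hS (t := 0) (by simp)
  have hw : ∀ t ∈ Set.Ico (0 : ℝ) 1, 0 ≤ h t * phi h t := fun t ht ↦ by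
    rw [h_mul_phi_of_bridge hh hσ hpos hS hhS ht]
    positivity
  have hφ (a b : ℝ) (ha : 0 ≤ a) (hab : a ≤ b) (hb : b < 1) :
      ∫ r in a..b, h r * phi h r = phi h a - phi h b := by
    rw [integral_eq_sub_of_hasDerivAt_Ioo (q := fun r ↦ h r * phi h r) (F := fun r ↦ -phi h r)
      (hh.mul (continuousOn_phi hh)) (continuousOn_phi hh).neg
      (fun x hx ↦ (hasDerivAt_phi hh hx).neg.congr_deriv (neg_neg _)) ha hab hb]
    ring
  have hcont : ∀ᵐ ω ∂P, ContinuousOn (fun t ↦ wienerByParts h M t ω) (Set.Iic 1) := by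
    -- Pinning enters through `X^{00} = φ M`, the boundary term of the integration by parts.
    filter_upwards [hMc, hpin 0 0, ae_intervalIntegrable_mul hh hM hMc hS0.le hw hφ
      fun t ht ↦ integral_div_phi_sq_of_bridge hh hσ hpos hS hhS (coe_mem_Ico le_rfl ht)]
      with ω hc hlim hi
    refine continuousOn_wienerByParts ?_ (by simpa [diffusion] using hlim) hi
    exact ((continuousOn_phi hh).comp NNReal.continuous_coe.continuousOn
      fun t ht ↦ coe_mem_Ico le_rfl ht).mul hc
  refine ⟨wienerByParts h M, isWienerIntegral_of_hasRep (hB := hB) hσ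
    (fun t ht ↦ hasRep_wienerByParts hh hσ hM hMc hφ ht) ?_, hcont⟩
  filter_upwards [hcont] with ω hω using hω.mono Set.Iio_subset_Iic_self

lemma BridgeCondition.isGaussianMarkov_and_areBridges (hbc : BridgeCondition h σ)
    (hh : ContinuousOn h (Set.Ico 0 1)) (hσ : ContinuousOn σ (Set.Ico 0 1))
    (hpos : ∀ t ∈ Set.Ico (0 : ℝ) 1, 0 < σ t)
    (hM : ∀ t : ℝ≥0, t < 1 → HasRep hB (M t)
      ((Set.Ico (0 : ℝ) t).indicator fun r ↦ σ r / phi h r))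
    (hN : IsWienerIntegral σ B N P)
    (hNc : ∀ᵐ ω ∂P, ContinuousOn (fun t ↦ N t ω) (Set.Iic 1)) :
    IsGaussianMarkov (fun x t ω ↦ x + N t ω) P ∧
      AreBridges (diffusion h M) P (fun x t ω ↦ x + N t ω) P := by
  obtain ⟨S, hS, hhS⟩ := hbc
  have hS0 : 0 < S := by simpa using integral_sq_lt_of_tendsto hσ hpos hS (t := 0) (by simp)
  have hS1 := integral_sq_zero_one hσ hpos hS
  have hNrep : ∀ t : ℝ≥0, t ≤ 1 → HasRep hB (N t) ((Set.Ico (0 : ℝ) t).indicator σ) :=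
    fun t ht ↦ hasRep_of_le_one hσ hpos hS hN hNc ht
  refine ⟨isGaussianMarkov_of_hasRep hNrep (fun t h0 h1 ↦ ?_) hNc,
    areBridges_of_hasRep hNrep hM hS0.ne' hS1
      (fun t ht ↦ phi_eq_of_bridge hh hσ hpos hS hhS (coe_mem_Ico le_rfl ht))
      fun t ht ↦ integral_div_phi_sq_of_bridge hh hσ hpos hS hhS (coe_mem_Ico le_rfl ht)⟩
  rcases h1.lt_or_eq with h1 | rfl
  · exact integral_sq_pos hσ hpos le_rfl (by exact_mod_cast h0) (by exact_mod_cast h1)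
  · rwa [NNReal.coe_one, hS1]

end BridgeCondition

end PinnedBridges

theorem theorem3p1 {Ω : Type u} [MeasurableSpace Ω] (P : Measure Ω) [IsProbabilityMeasure P]
    (B : ℝ≥0 → Ω → ℝ) (hB : IsBrownianReal B P)
    (h σ : ℝ → ℝ) (hh : ContinuousOn h (Set.Ico 0 1)) (hσ : ContinuousOn σ (Set.Ico 0 1))
    (hσ_pos : ∀ t ∈ Set.Ico (0 : ℝ) 1, 0 < σ t)
    (M : ℝ≥0 → Ω → ℝ)
    (hM : PinnedBridges.IsWienerIntegral (fun r ↦ σ r / PinnedBridges.phi h r) B M P)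
    (hpin : PinnedBridges.IsPinned (PinnedBridges.diffusion h M) P) :
    ((∃ (Ω' : Type u) (_ : MeasurableSpace Ω') (P' : Measure Ω') (_ : IsProbabilityMeasure P')
        (Z : ℝ → ℝ≥0 → Ω' → ℝ), PinnedBridges.IsGaussianMarkov Z P' ∧
          PinnedBridges.AreBridges (PinnedBridges.diffusion h M) P Z P') ↔
      PinnedBridges.BridgeCondition h σ) ∧
    (PinnedBridges.BridgeCondition h σ →
      (∃ N : ℝ≥0 → Ω → ℝ, PinnedBridges.IsWienerIntegral σ B N P ∧
        ∀ᵐ ω ∂P, ContinuousOn (fun t ↦ N t ω) (Set.Iic 1)) ∧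
      ∀ N : ℝ≥0 → Ω → ℝ, PinnedBridges.IsWienerIntegral σ B N P →
        (∀ᵐ ω ∂P, ContinuousOn (fun t ↦ N t ω) (Set.Iic 1)) →
        PinnedBridges.IsGaussianMarkov (fun x t ω ↦ x + N t ω) P ∧
        PinnedBridges.AreBridges (PinnedBridges.diffusion h M) P (fun x t ω ↦ x + N t ω) P) := by
  have hMrep : ∀ t : ℝ≥0, t < 1 → PinnedBridges.HasRep hB.toIsPreBrownianReal (M t)
      ((Set.Ico (0 : ℝ) t).indicator fun r ↦ σ r / PinnedBridges.phi h r) :=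
    fun t ht ↦ hM.hasRep _ (PinnedBridges.continuousOn_div_phi hh hσ) ht
  have hexists (hbc : PinnedBridges.BridgeCondition h σ) :=
    hbc.exists_isWienerIntegral hh hσ hσ_pos hMrep hM.continuous hpin
  have hforall (hbc : PinnedBridges.BridgeCondition h σ) (N : ℝ≥0 → Ω → ℝ) :=
    hbc.isGaussianMarkov_and_areBridges (N := N) hh hσ hσ_pos hMrep
  refine ⟨⟨?_, fun hbc ↦ ?_⟩, fun hbc ↦ ⟨hexists hbc, hforall hbc⟩⟩
  · rintro ⟨Ω', _, P', _, Z, hZ, hbr⟩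
    exact hbr.bridgeCondition hZ hh hσ hσ_pos hMrep hpin
  · obtain ⟨N, hN, hNc⟩ := hexists hbc
    exact ⟨Ω, _, P, inferInstance, _, hforall hbc N hN hNc⟩
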